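/- Let $V$ be a finite set and let $E\subseteq V\times V$ be a set of directed edges without loops; write $x\to y$ if $(x,y)\in E$ and $\mathcal N_x=\{y: x\to y\}$. For each edge $x\to y$ let $\psi(\cdot\,|\,x\to y)\ge 0$ be a probability density on $(0,\infty)$ (the density of the waiting time of the jump event $x\to y$). For $t\ge 0$ put $$a(t\,|\,x)=\prod_{y\in\mathcal N_x}\int_t^\infty\psi(u\,|\,x\to y)\,du,\qquad b(t,x\to y)=\Big(\prod_{z\in\mathcal N_x,\,z\ne y}\int_t^\infty\psi(u\,|\,x\to z)\,du\Big)\psi(t\,|\,x\to y)\quad(y\in\mathcal N_x),$$ and $b(t,x\to y)=0$ for $y\notin\mathcal N_x$. Let $\kappa(x)=\int_0^\infty a(u\,|\,x)\,du\in(0,\infty]$ be the mean holding time at $x$, and let $p(y\,|\,x)=\int_0^\infty b(u,x\to y)\,du$ if $\mathcal N_x\neq\emptyset$, $p(y\,|\,x)=\delta_x(y)$ if $\mathcal N_x=\emptyset$. Let $A,B\subset V$ be disjoint and nonempty, and let $q(x)=\mathbb P(\tau_{B,x}<\tau_{A,x})$, where $\tau_{A,x},\tau_{B,x}\in\{0,1,2,\dots\}\cup\{+\infty\}$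 are the first hitting times of $A$ and $B$ by the discrete-time Markov chain with transition probabilities $p$ started at $x$. Assume that this discrete-time chain is ergodic (irreducible and aperiodic), and let $m$ be its invariant probability measure. Let $(x_0,t_0),(x_1,t_1),\dots$ be a random trajectory of the continuous-time jump process with $t_0=0$ and an arbitrary distribution of $x_0$, the process jumping from $x_k$ to $x_{k+1}$ at time $t_{k+1}$; that is, for all $n$, all nodes $y_0,\dots,y_n$ and all Borel sets $S_0,\dots,S_{n-1}\subseteq\mathbb R$, $$\mathbb P\big(x_k=y_k\ (0\le k\le n),\ t_{k+1}-t_k\in S_k\ (0\le k<n)\big)=\mathbb P(x_0=y_0)\prod_{k=0}^{n-1}\int_{S_k\cap(0,\infty)}b(u,y_k\to y_{k+1})\,du .$$ Put $\tau_B^{(0)}=0$ and, for $k\ge 0$, $\tau_A^{(k+1)}=\min\{l\ge\tau_B^{(k)}: x_l\in A\}$, $\tau_B^{(k+1)}=\min\{l\ge\tau_A^{(k+1)}: x_l\in B\}$ (with $\min\emptyset=+\infty$), and let $M=M(N)$ be the integer with $\tau_B^{(M)}\le N<\tau_B^{(M+1)}$. Then, almost surely, the limit $k_{AB}=\lim_{N\to\infty}M(N)/t_N$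 (the reaction rate between $A$ and $B$) exists and $$k_{AB}=\frac{\sum_{x\in A}\sum_{y\in V}m(x)\,p(y\,|\,x)\,q(y)}{\sum_{x\in V}m(x)\,\kappa(x)},$$ where the right-hand side is read as $0$ if $\kappa(x)=\infty$ for some $x$. -/

import Mathlib

open MeasureTheory ProbabilityTheory Filter Topology
open scoped ENNReal

/-- A network on the node set `V` without loop edges. For each edge `x → y` the function
`ψ x y`, restricted to `(0, ∞)`, is the probability density of the waiting time of the jump event
`x → y`. (The values of `ψ x y` off the edges, or at negative times, are never used; an integral
equal to `1` forces integrability.) -/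
structure JumpNetwork (V : Type*) where
  Adj : V → V → Prop
  no_loop : ∀ x, ¬ Adj x x
  ψ : V → V → ℝ → ℝ
  measurable_ψ : ∀ x y, Adj x y → Measurable (ψ x y)
  ψ_nonneg : ∀ x y, Adj x y → ∀ t, 0 < t → 0 ≤ ψ x y t
  integral_ψ : ∀ x y, Adj x y → ∫ t in Set.Ioi (0 : ℝ), ψ x y t = 1

/-- Two finite measures on the line, the second without atoms: Fubini's theorem for the
"first of two independent clocks". -/
theorem first_of_two_clocks (α β : Measure ℝ) [IsFiniteMeasure α] [IsFiniteMeasure β]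
    [NullSingletonClass β] (t : ℝ) :
    ∫⁻ u in Set.Ioi t, β (Set.Ioi u) ∂α + ∫⁻ u in Set.Ioi t, α (Set.Ioi u) ∂β
      = α (Set.Ioi t) * β (Set.Ioi t) := by
  set α' := α.restrict (Set.Ioi t) with hα
  set β' := β.restrict (Set.Ioi t) with hβ
  have h1 : ∫⁻ u in Set.Ioi t, β (Set.Ioi u) ∂α = (α'.prod β') {z | z.1 < z.2} := by
    rw [Measure.prod_apply (measurableSet_lt measurable_fst measurable_snd)]
    refine setLIntegral_congr_fun measurableSet_Ioi (fun u hu => ?_)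
    have : Prod.mk u ⁻¹' {z : ℝ × ℝ | z.1 < z.2} = Set.Ioi u := by ext; simp
    rw [this, hβ, Measure.restrict_apply measurableSet_Ioi,
      Set.inter_eq_left.2 (Set.Ioi_subset_Ioi (le_of_lt hu))]
  have h2 : ∫⁻ u in Set.Ioi t, α (Set.Ioi u) ∂β = (α'.prod β') {z | z.2 < z.1} := by
    rw [Measure.prod_apply_symm (measurableSet_lt measurable_snd measurable_fst)]
    refine setLIntegral_congr_fun measurableSet_Ioi (fun u hu => ?_)
    have : (fun x => (x, u)) ⁻¹' {z : ℝ × ℝ | z.2 < z.1} = Set.Ioi u := by ext; simp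
    rw [this, hα, Measure.restrict_apply measurableSet_Ioi,
      Set.inter_eq_left.2 (Set.Ioi_subset_Ioi (le_of_lt hu))]
  have h3 : (α'.prod β') {z | z.1 = z.2} = 0 := by
    rw [Measure.prod_apply (measurableSet_eq_fun measurable_fst measurable_snd)]
    have : ∀ u : ℝ, Prod.mk u ⁻¹' {z : ℝ × ℝ | z.1 = z.2} = {u} := by
      intro u; ext v; simp [eq_comm]
    have hz : ∀ u : ℝ, β' {u} = 0 := fun u =>
      le_antisymm ((Measure.restrict_apply_le _ _).trans (by simp)) zero_le
    simp [this, hz]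
  have h4 : (α'.prod β') Set.univ = α (Set.Ioi t) * β (Set.Ioi t) := by
    rw [← Set.univ_prod_univ, Measure.prod_prod]; simp [hα, hβ]
  have hu : (Set.univ : Set (ℝ × ℝ)) = ({z | z.1 < z.2} ∪ {z | z.2 < z.1}) ∪ {z | z.1 = z.2} := by
    ext z
    simp only [Set.mem_univ, Set.mem_union, Set.mem_ofPred_eq, true_iff]
    rcases lt_trichotomy z.1 z.2 with h | h | h <;> simp [h]
  have hd : Disjoint {z : ℝ × ℝ | z.1 < z.2} {z | z.2 < z.1} :=
    Set.disjoint_left.2 fun z h h' => lt_asymm (Set.mem_ofPred_eq ▸ h) h'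
  rw [h1, h2, ← h4, hu, ← measure_union hd (measurableSet_lt measurable_snd measurable_fst)]
  exact le_antisymm (measure_mono Set.subset_union_left)
    ((measure_union_le _ _).trans (by rw [h3, add_zero]))

/-- The tail of a measure on the line is a measurable function. -/
theorem measurable_tail (μ : Measure ℝ) : Measurable fun u => μ (Set.Ioi u) :=
  Antitone.measurable fun _ _ h => measure_mono (Set.Ioi_subset_Ioi h)

/-- Exactly one of finitely many independent clocks without atoms rings first. -/
theorem first_of_clocks {ι : Type*} [DecidableEq ι] (μ : ι → Measure ℝ)
    (s : Finset ι) (hs : s.Nonempty)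
    (hf : ∀ i ∈ s, IsFiniteMeasure (μ i)) (ha : ∀ i ∈ s, NullSingletonClass (μ i)) (t : ℝ) :
    ∑ i ∈ s, ∫⁻ u in Set.Ioi t, ∏ j ∈ s.erase i, μ j (Set.Ioi u) ∂(μ i)
      = ∏ i ∈ s, μ i (Set.Ioi t) := by
  induction hs using Finset.Nonempty.cons_induction generalizing t with
  | singleton i => simp
  | cons k s hk hs ih =>
    have hf' : ∀ i ∈ s, IsFiniteMeasure (μ i) := fun i hi => hf i (by simp [hi])
    have hfk : IsFiniteMeasure (μ k) := hf k (by simp)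
    have hak : NullSingletonClass (μ k) := ha k (by simp)
    have ih := ih hf' (fun i hi => ha i (by simp [hi]))
    set ν : Measure ℝ := ∑ i ∈ s, (μ i).withDensity
      (fun u => ∏ j ∈ s.erase i, μ j (Set.Ioi u)) with hν
    have hm : ∀ i, Measurable fun u => ∏ j ∈ s.erase i, μ j (Set.Ioi u) := fun i =>
      Finset.measurable_prod _ fun j _ => measurable_tail (μ j)
    have hνt : ∀ u, ν (Set.Ioi u) = ∏ i ∈ s, μ i (Set.Ioi u) := by
      intro u
      rw [hν, Measure.finsetSum_apply, ← ih u]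
      exact Finset.sum_congr rfl fun i _ => withDensity_apply _ measurableSet_Ioi
    have hνf : IsFiniteMeasure ν := by
      rw [hν]
      have : ∀ i ∈ s, IsFiniteMeasure ((μ i).withDensity
          (fun u => ∏ j ∈ s.erase i, μ j (Set.Ioi u))) := by
        intro i hi
        have := hf' i hi
        refine isFiniteMeasure_withDensity (ne_of_lt ?_)
        calc ∫⁻ u, ∏ j ∈ s.erase i, μ j (Set.Ioi u) ∂(μ i)
            ≤ ∫⁻ _, ∏ j ∈ s.erase i, μ j Set.univ ∂(μ i) :=
              lintegral_mono fun u => Finset.prod_le_prod' fun j _ =>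
                measure_mono (Set.subset_univ _)
          _ = (∏ j ∈ s.erase i, μ j Set.univ) * μ i Set.univ := by simp
          _ < ⊤ := ENNReal.mul_lt_top (ENNReal.prod_lt_top fun j hj => by
              have := hf' j (Finset.mem_of_mem_erase hj)
              exact measure_lt_top _ _) (measure_lt_top _ _)
      refine ⟨?_⟩
      rw [Measure.finsetSum_apply]
      exact ENNReal.sum_lt_top.2 fun i hi => (this i hi).measure_univ_lt_top
    have key := first_of_two_clocks ν (μ k) t
    rw [hνt t] at key
    rw [Finset.sum_cons, Finset.prod_cons, mul_comm, ← key, add_comm]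
    congr 1
    · have hr : ν.restrict (Set.Ioi t) = ∑ i ∈ s, ((μ i).withDensity
          (fun u => ∏ j ∈ s.erase i, μ j (Set.Ioi u))).restrict (Set.Ioi t) :=
        map_sum (Measure.restrictₗ (Set.Ioi t)) _ _
      rw [hr, lintegral_finsetSum_measure]
      refine Finset.sum_congr rfl fun i hi => ?_
      have hne : k ≠ i := fun h => hk (h ▸ hi)
      rw [restrict_withDensity measurableSet_Ioi, lintegral_withDensity_eq_lintegral_mul _ (hm i)
        (measurable_tail (μ k))]
      refine lintegral_congr fun u => ?_
      have : (Finset.cons k s hk).erase i = Finset.cons k (s.erase i) (by simp [hk]) := by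
        ext j; simp only [Finset.mem_erase, Finset.mem_cons]; grind
      rw [this, Finset.prod_cons, Pi.mul_apply, mul_comm]
    · refine lintegral_congr fun u => ?_
      rw [hνt u, Finset.cons_eq_insert, Finset.erase_insert hk]

namespace JumpNetwork

variable {V : Type*} [Fintype V] (G : JumpNetwork V)

open Classical in
/-- The set `𝒩_x` of nodes that can be reached directly from `x`. -/
noncomputable def nbr (x : V) : Finset V := Finset.univ.filter fun y => G.Adj x y

/-- `x` is a sink if no edge leaves it. -/
def IsSink (x : V) : Prop := ∀ y, ¬ G.Adj x y

/-- The probability that the waiting time of the jump event `x → y` exceeds `t`. -/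
noncomputable def tail (x y : V) (t : ℝ) : ℝ := ∫ u in Set.Ioi t, G.ψ x y u

/-- `a(t | x)`: the probability that the system stays at `x` longer than `t`. -/
noncomputable def a (x : V) (t : ℝ) : ℝ := ∏ y ∈ G.nbr x, G.tail x y t

open Classical in
/-- `b(t, x → y)`: the density of the event that the system leaves `x` at time `t` (after its
arrival), and jumps to `y`. -/
noncomputable def b (x y : V) (t : ℝ) : ℝ :=
  if G.Adj x y then (∏ z ∈ (G.nbr x).erase y, G.tail x z t) * G.ψ x y t else 0

/-- `κ(x) = ∫₀^∞ a(u | x) du`: the mean holding time at `x`, possibly infinite. -/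
noncomputable def κ (x : V) : ℝ≥0∞ := ∫⁻ t in Set.Ioi (0 : ℝ), ENNReal.ofReal (G.a x t)

open Classical in
/-- The transition matrix of the embedded discrete-time chain: `G.p x y` is the probability
`p(y | x)` that the system jumps from `x` to `y`; sinks are absorbing. -/
noncomputable def p : Matrix V V ℝ := fun x y =>
  if G.IsSink x then (if y = x then 1 else 0) else ∫ t in Set.Ioi (0 : ℝ), G.b x y t

theorem p_nonneg (x y : V) : 0 ≤ G.p x y := by
  classical
  have htail : ∀ z ∈ G.nbr x, ∀ t, 0 < t → 0 ≤ G.tail x z t := fun z hz t ht =>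
    setIntegral_nonneg measurableSet_Ioi fun u hu =>
      G.ψ_nonneg x z (by simpa [nbr] using hz) u (lt_trans ht hu)
  unfold p
  split_ifs with h1 h2
  · exact zero_le_one
  · exact le_rfl
  · refine setIntegral_nonneg measurableSet_Ioi fun t ht => ?_
    unfold b
    split_ifs with h
    · exact mul_nonneg (Finset.prod_nonneg fun z hz => htail z (Finset.mem_of_mem_erase hz) t ht)
        (G.ψ_nonneg x y h t ht)
    · exact le_rfl

/-- The jump probabilities out of a node sum to one. -/
theorem sum_p (x : V) : ∑ y, G.p x y = 1 := by
  classical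
  by_cases hx : G.IsSink x
  · simp [p, hx]
  have hadj : ∀ {y}, y ∈ G.nbr x ↔ G.Adj x y := by intro y; simp [nbr]
  have hne : (G.nbr x).Nonempty := by
    unfold IsSink at hx
    push Not at hx
    obtain ⟨y, hy⟩ := hx
    exact ⟨y, hadj.2 hy⟩
  set μ : V → Measure ℝ := fun y =>
    (volume.restrict (Set.Ioi (0 : ℝ))).withDensity (fun t => ENNReal.ofReal (G.ψ x y t)) with hμ
  have hint : ∀ y ∈ G.nbr x, IntegrableOn (G.ψ x y) (Set.Ioi 0) := fun y hy => by
    by_contra hcon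
    have h := G.integral_ψ x y (hadj.1 hy)
    rw [integral_undef hcon] at h
    exact zero_ne_one h
  have hμt : ∀ y ∈ G.nbr x, ∀ t, 0 ≤ t → μ y (Set.Ioi t) = ENNReal.ofReal (G.tail x y t) := by
    intro y hy t ht
    have hsub : Set.Ioi t ⊆ Set.Ioi (0 : ℝ) := Set.Ioi_subset_Ioi ht
    rw [hμ]
    simp only
    rw [withDensity_apply _ measurableSet_Ioi, Measure.restrict_restrict measurableSet_Ioi,
      Set.inter_eq_left.2 hsub, tail, ofReal_integral_eq_lintegral_ofReal]
    · exact (hint y hy).mono_set hsub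
    · exact (ae_restrict_mem measurableSet_Ioi).mono fun u hu =>
        G.ψ_nonneg x y (hadj.1 hy) u (lt_of_le_of_lt ht hu)
  have hμ0 : ∀ y ∈ G.nbr x, μ y (Set.Ioi 0) = 1 := fun y hy => by
    rw [hμt y hy 0 le_rfl, tail, G.integral_ψ x y (hadj.1 hy), ENNReal.ofReal_one]
  have hμf : ∀ y ∈ G.nbr x, IsFiniteMeasure (μ y) := fun y hy =>
    ⟨by
      have : μ y Set.univ = μ y (Set.Ioi 0) := by
        simp [hμ, withDensity_apply _ measurableSet_Ioi]
      rw [this, hμ0 y hy]; exact ENNReal.one_lt_top⟩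
  have key := first_of_clocks μ (G.nbr x) hne hμf (fun y _ => by rw [hμ]; infer_instance) 0
  rw [Finset.prod_congr rfl hμ0, Finset.prod_const_one] at key
  have htail0 : ∀ z ∈ G.nbr x, ∀ t, 0 ≤ t → 0 ≤ G.tail x z t := fun z hz t ht =>
    setIntegral_nonneg measurableSet_Ioi fun u hu =>
      G.ψ_nonneg x z (hadj.1 hz) u (lt_of_le_of_lt ht hu)
  have hb : ∀ y ∈ G.nbr x, ENNReal.ofReal (G.p x y) =
      ∫⁻ u in Set.Ioi 0, ∏ j ∈ (G.nbr x).erase y, μ j (Set.Ioi u) ∂(μ y) := by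
    intro y hy
    have hmt : Measurable fun u => ∏ j ∈ (G.nbr x).erase y, μ j (Set.Ioi u) :=
      Finset.measurable_prod _ fun j _ => measurable_tail (μ j)
    have hmψ : Measurable (G.ψ x y) := G.measurable_ψ x y (hadj.1 hy)
    have e1 : ∫⁻ u in Set.Ioi 0, ∏ j ∈ (G.nbr x).erase y, μ j (Set.Ioi u) ∂(μ y)
        = ∫⁻ u in Set.Ioi (0 : ℝ), ENNReal.ofReal (G.b x y u) := by
      rw [hμ]
      simp only
      rw [restrict_withDensity measurableSet_Ioi,
        lintegral_withDensity_eq_lintegral_mul _ hmψ.ennreal_ofReal hmt,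
        Measure.restrict_restrict measurableSet_Ioi, Set.inter_self]
      refine setLIntegral_congr_fun measurableSet_Ioi fun u hu => ?_
      simp only [Pi.mul_apply, b, if_pos (hadj.1 hy)]
      rw [mul_comm, ENNReal.ofReal_mul (Finset.prod_nonneg fun z hz =>
        htail0 z (Finset.mem_of_mem_erase hz) u (le_of_lt hu)),
        ENNReal.ofReal_prod_of_nonneg fun z hz =>
          htail0 z (Finset.mem_of_mem_erase hz) u (le_of_lt hu)]
      congr 1
      exact Finset.prod_congr rfl fun z hz =>
        hμt z (Finset.mem_of_mem_erase hz) u (le_of_lt hu)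
    have hle : ∫⁻ u in Set.Ioi (0 : ℝ), ENNReal.ofReal (G.b x y u) ≤ 1 := by
      rw [← e1, ← key]
      exact Finset.single_le_sum (f := fun i => ∫⁻ u in Set.Ioi 0,
        ∏ j ∈ (G.nbr x).erase i, μ j (Set.Ioi u) ∂(μ i)) (fun _ _ => zero_le) hy
    have hnn : 0 ≤ᵐ[volume.restrict (Set.Ioi (0 : ℝ))] G.b x y :=
      (ae_restrict_mem measurableSet_Ioi).mono fun u hu => by
        simp only [b, if_pos (hadj.1 hy)]
        exact mul_nonneg (Finset.prod_nonneg fun z hz =>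
          htail0 z (Finset.mem_of_mem_erase hz) u (le_of_lt hu))
          (G.ψ_nonneg x y (hadj.1 hy) u hu)
    have hmb : AEStronglyMeasurable (G.b x y) (volume.restrict (Set.Ioi (0 : ℝ))) := by
      have hm2 : Measurable fun u =>
          (∏ j ∈ (G.nbr x).erase y, (μ j (Set.Ioi u)).toReal) * G.ψ x y u :=
        (Finset.measurable_prod _ fun j _ => (measurable_tail (μ j)).ennreal_toReal).mul hmψ
      refine hm2.aestronglyMeasurable.congr ?_
      refine (ae_restrict_mem measurableSet_Ioi).mono fun u hu => ?_
      simp only [b, if_pos (hadj.1 hy)]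
      congr 1
      refine Finset.prod_congr rfl fun z hz => ?_
      have hz' := Finset.mem_of_mem_erase hz
      rw [hμt z hz' u (le_of_lt hu), ENNReal.toReal_ofReal (htail0 z hz' u (le_of_lt hu))]
    have hbi : Integrable (G.b x y) (volume.restrict (Set.Ioi (0 : ℝ))) :=
      ⟨hmb, (hasFiniteIntegral_iff_ofReal hnn).2 (lt_of_le_of_lt hle ENNReal.one_lt_top)⟩
    rw [e1, p, if_neg hx, ofReal_integral_eq_lintegral_ofReal hbi hnn]
  have hout : ∀ y, y ∉ G.nbr x → G.p x y = 0 := by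
    intro y hy
    have : ¬ G.Adj x y := fun h => hy (hadj.2 h)
    simp [p, hx, b, this]
  rw [← Finset.sum_congr rfl hb, ← ENNReal.ofReal_sum_of_nonneg fun y _ => G.p_nonneg x y,
    ENNReal.ofReal_eq_one] at key
  rw [← key]
  exact (Finset.sum_subset (Finset.subset_univ _) fun y _ hy => hout y hy).symm

variable [MeasurableSpace V] [MeasurableSingletonClass V]

/-- One step of the embedded chain, as a Markov kernel. -/
noncomputable def step : Kernel V V :=
  Kernel.ofFunOfCountable fun x => ∑ y, ENNReal.ofReal (G.p x y) • Measure.dirac y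

instance : IsMarkovKernel G.step where
  isProbabilityMeasure x := ⟨by
    change (∑ y, ENNReal.ofReal (G.p x y) • Measure.dirac y) Set.univ = 1
    rw [Measure.finsetSum_apply]
    simp [← ENNReal.ofReal_sum_of_nonneg fun y _ => G.p_nonneg x y, G.sum_p x]⟩

/-- The law, on the space of all sequences of nodes, of the embedded chain started at `x`. -/
noncomputable def chainLaw (x : V) : Measure (ℕ → V) :=
  Kernel.trajMeasure (X := fun _ => V) (Measure.dirac x) fun n =>
    G.step.comap (fun h : (∀ _ : Finset.Iic n, V) => h ⟨n, Finset.mem_Iic.2 le_rfl⟩)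
      (measurable_pi_apply _)

end JumpNetwork

/-- The first time `l ≥ n` at which the sequence `w` is in `S` (`⊤` if there is none). -/
noncomputable def hitFrom {V : Type*} (w : ℕ → V) (S : Set V) (n : ℕ∞) : ℕ∞ :=
  ⨅ (l : ℕ) (_ : n ≤ l ∧ w l ∈ S), (l : ℕ∞)

/-- The committor `q(x) = ℙ(τ_{B,x} < τ_{A,x})` of the embedded chain. -/
noncomputable def JumpNetwork.q {V : Type*} [Fintype V] [MeasurableSpace V]
    [MeasurableSingletonClass V] (G : JumpNetwork V) (A B : Set V) (x : V) : ℝ :=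
  (G.chainLaw x).real {w | hitFrom w B 0 < hitFrom w A 0}

/-- The successive times `τ_B^{(k)}`: `τ_B^{(0)} = 0`, and `τ_B^{(k+1)}` is the first visit to `B`
from the time `τ_A^{(k+1)}` on, which is the first visit to `A` from the time `τ_B^{(k)}` on. -/
noncomputable def tauB {V : Type*} (w : ℕ → V) (A B : Set V) : ℕ → ℕ∞
  | 0 => 0
  | k + 1 => hitFrom w B (hitFrom w A (tauB w A B k))

/-- The number `M = M(N)` with `τ_B^{(M)} ≤ N < τ_B^{(M+1)}`. -/
noncomputable def numReactive {V : Type*} (w : ℕ → V) (A B : Set V) (N : ℕ) : ℕ :=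
  sSup {k : ℕ | tauB w A B k ≤ N}

theorem le_hitFrom {V : Type*} (w : ℕ → V) (S : Set V) (n : ℕ∞) : n ≤ hitFrom w S n :=
  le_iInf₂ fun _ h => h.1

theorem hitFrom_mem {V : Type*} (w : ℕ → V) (S : Set V) (n : ℕ∞) (j : ℕ)
    (h : hitFrom w S n = j) : w j ∈ S := by
  have h1 : hitFrom w S n < ((j + 1 : ℕ) : ℕ∞) := by rw [h]; exact_mod_cast Nat.lt_succ_self j
  unfold hitFrom at h1
  obtain ⟨l, hl⟩ := iInf_lt_iff.1 h1
  obtain ⟨hl1, hl2⟩ := iInf_lt_iff.1 hl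
  have h2 : (j : ℕ∞) ≤ l := h ▸ iInf₂_le l hl1
  have : l = j := le_antisymm (Nat.lt_succ_iff.1 (by exact_mod_cast hl2)) (by exact_mod_cast h2)
  exact this ▸ hl1.2

/-- `numReactive` is characterised by `τ_B^{(M)} ≤ N < τ_B^{(M+1)}`. -/
theorem numReactive_spec {V : Type*} (w : ℕ → V) {A B : Set V} (hAB : Disjoint A B) (N : ℕ) :
    tauB w A B (numReactive w A B N) ≤ N ∧ (N : ℕ∞) < tauB w A B (numReactive w A B N + 1) := by
  have hstep : ∀ k, tauB w A B k ≤ tauB w A B (k + 1) := fun k =>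
    (le_hitFrom _ _ _).trans (le_hitFrom _ _ _)
  have hk : ∀ k : ℕ, (k : ℕ∞) ≤ tauB w A B k := by
    intro k
    induction k with
    | zero => exact zero_le
    | succ k ih =>
      by_contra! hlt
      obtain ⟨j, hj⟩ := ENat.ne_top_iff_exists.1 (ne_top_of_lt hlt)
      have h1 : (k : ℕ∞) ≤ hitFrom w A (tauB w A B k) := ih.trans (le_hitFrom _ _ _)
      have h2 : hitFrom w A (tauB w A B k) ≤ tauB w A B (k + 1) := le_hitFrom _ _ _
      have hjk : j = k := by
        rw [← hj] at hlt h2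
        have a1 : j < k + 1 := by exact_mod_cast hlt
        have a2 : k ≤ j := by exact_mod_cast h1.trans h2
        omega
      subst hjk
      have hA : hitFrom w A (tauB w A B j) = j := le_antisymm (hj ▸ h2) h1
      exact Set.disjoint_left.1 hAB (hitFrom_mem w A _ j hA) (hitFrom_mem w B _ j hj.symm)
  have hbdd : BddAbove {k : ℕ | tauB w A B k ≤ N} :=
    ⟨N, fun k h => by exact_mod_cast (hk k).trans h⟩
  have hmem : sSup {k : ℕ | tauB w A B k ≤ N} ∈ {k : ℕ | tauB w A B k ≤ N} :=
    Nat.sSup_mem ⟨0, by simp [tauB]⟩ hbdd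
  refine ⟨hmem, ?_⟩
  by_contra! h
  exact absurd (le_csSup hbdd h) (by simp [numReactive])

/-- `X 0, X 1, …` and `t 0 = 0, t 1, …` are the successive nodes and jump times of a trajectory of
the continuous-time jump process on `G` (with an arbitrary initial distribution): the process
starts at time `0`, and jumps from `X k` to `X (k + 1)` at time `t (k + 1)`. The joint density of
nodes and holding times along a path is the initial probability times the product of the
`b(t_{k+1} - t_k, x_k → x_{k+1})`. Such an infinite trajectory exists
if no sink can be reached. -/
structure IsJumpTrajectory {V : Type*} [Fintype V] [MeasurableSpace V] (G : JumpNetwork V)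
    {Ω : Type*} [MeasurableSpace Ω] (P : Measure Ω) (X : ℕ → Ω → V) (t : ℕ → Ω → ℝ) : Prop where
  measurable_X : ∀ n, Measurable (X n)
  measurable_t : ∀ n, Measurable (t n)
  t_zero : ∀ ω, t 0 ω = 0
  law : ∀ (n : ℕ) (x : ℕ → V) (S : ℕ → Set ℝ), (∀ k, MeasurableSet (S k)) →
    P.real {ω | (∀ k ≤ n, X k ω = x k) ∧ ∀ k < n, t (k + 1) ω - t k ω ∈ S k} =
      P.real {ω | X 0 ω = x 0} *
        ∏ k ∈ Finset.range n, ∫ u in Set.Ioi 0 ∩ S k, G.b (x k) (x (k + 1)) u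

/-- A chain with transition matrix `p` is ergodic: irreducible and aperiodic. -/
structure IsErgodicChain {V : Type*} [Fintype V] [DecidableEq V] (p : Matrix V V ℝ) : Prop where
  irreducible : p.IsIrreducible
  aperiodic : ∀ x, ∀ d : ℕ, (∀ k, 0 < k → 0 < (p ^ k) x x → d ∣ k) → d = 1

/-- `m` is an invariant probability measure of the chain with transition matrix `p`. -/
structure IsInvariantProb {V : Type*} [Fintype V] (p : Matrix V V ℝ) (m : V → ℝ) : Prop where
  nonneg : ∀ x, 0 ≤ m x
  sum_eq_one : ∑ x, m x = 1
  invariant : ∀ y, ∑ x, m x * p x y = m y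

/-- `k` is the reaction rate `k_AB = lim_{N → ∞} M(N) / t_N`, along almost every trajectory. -/
def IsReactionRate {V : Type*} {Ω : Type*} [MeasurableSpace Ω] (P : Measure Ω)
    (X : ℕ → Ω → V) (t : ℕ → Ω → ℝ) (A B : Set V) (k : ℝ) : Prop :=
  ∀ᵐ ω ∂P, Tendsto (fun N : ℕ => (numReactive (fun n => X n ω) A B N : ℝ) / t N ω) atTop (𝓝 k)

/-! Numerator and denominator are divided by `N`; each then has an almost sure limit. Given the
past, the pair (next node, holding time) has the law `jumpLaw x`, which depends only on the current
node `x`. Its marginals are `p` and a holding time of mean `κ x`; both facts rest on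
`first_of_clocks`.

The engine is the law of large numbers `path_lln`, for sums along a path read by a finite automaton.
Each state of the automaton receives an infinite stack of independent cards with the law of the next
step, and the path is built by drawing the next unused card from the stack of the current state. The
drawn path has the prescribed law, since a fixed path uses pairwise distinct cards (`drawn_law`). A
centred sum along it splits into one i.i.d. sum per stack, each of length at most `N`, so the
ordinary strong law shows that it is `o(N)`; no recurrence is needed.

Applied to indicators, this shows that the occupation frequencies are almost invariant under `p`. By
compactness of the simplex and uniqueness of the invariant measure they converge to `m`
(`IsInvariantProb.tendsto_visits`). Hence `t_N / N` tends to `∑ m κ` if all `κ` are finite;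
otherwise truncating the holding times shows that it diverges.

For `M(N)`, a flag records whether the last visit to `A ∪ B` was in `A`. Then `M(N)` counts the
arrivals in `B` with the flag set (`numReactive_eq_arrivals`). While the flag is set, the committor
`q` climbs from `0` on `A` to `1` on `B`. Off `A ∪ B` it is harmonic, so its increments are centred
there, and the only drift is `(p q)(x)` at visits to `x ∈ A` (`arrivals_eq_sum`). So `M(N) / N`
tends to `∑_{x ∈ A} m(x) (p q)(x)`. -/

/-! ### Uniqueness of measures on sequence spaces, and a lemma on averages -/

/-- Two finite measures on sequences agree if they agree on all boxes whose sides belong to a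
`π`-system that generates the `σ`-algebra and has a countable subfamily covering the space. -/
theorem measure_ext_of_boxes {α : Type*} [mα : MeasurableSpace α] {C : Set (Set α)}
    (hC : mα = MeasurableSpace.generateFrom C) (hpi : IsPiSystem C)
    {D : Set (Set α)} (hDC : D ⊆ C) (hD : D.Countable) (hDu : ⋃₀ D = Set.univ)
    {μ ν : Measure (ℕ → α)} [IsProbabilityMeasure μ] [IsProbabilityMeasure ν]
    (h : ∀ (n : ℕ) (S : ℕ → Set α), (∀ k, S k ∈ C) →
      μ {z | ∀ k ≤ n, z k ∈ S k} = ν {z | ∀ k ≤ n, z k ∈ S k}) : μ = ν := by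
  rcases D.eq_empty_or_nonempty with rfl | ⟨T₀, hT₀⟩
  · have : IsEmpty α := by
      rw [Set.sUnion_empty] at hDu
      exact Set.univ_eq_empty_iff.1 hDu.symm
    have h1 : μ Set.univ = 1 := measure_univ
    rw [Set.univ_eq_empty_iff.2 inferInstance, measure_empty] at h1
    exact absurd h1 zero_ne_one
  have hmC : ∀ s ∈ C, MeasurableSet s := fun s hs => by
    rw [hC]; exact MeasurableSpace.measurableSet_generateFrom hs
  set 𝓑 : Set (Set (ℕ → α)) :=
    {B | ∃ (n : ℕ) (S : ℕ → Set α), (∀ k, S k ∈ C) ∧ B = {z | ∀ k ≤ n, z k ∈ S k}} with h𝓑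
  have hbox : ∀ (n : ℕ) (S : ℕ → Set α), (∀ k, S k ∈ C) →
      MeasurableSet {z : ℕ → α | ∀ k ≤ n, z k ∈ S k} := fun n S hS => by
    have : {z : ℕ → α | ∀ k ≤ n, z k ∈ S k} = ⋂ k, ⋂ (_ : k ≤ n), (fun z => z k) ⁻¹' S k := by
      ext; simp
    rw [this]
    exact MeasurableSet.iInter fun k => MeasurableSet.iInter fun _ =>
      (measurable_pi_apply k) (hmC _ (hS k))
  have hgen : (MeasurableSpace.pi : MeasurableSpace (ℕ → α)) =
      MeasurableSpace.generateFrom 𝓑 := by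
    refine le_antisymm ?_ (MeasurableSpace.generateFrom_le ?_)
    · refine iSup_le fun k => ?_
      rw [hC, MeasurableSpace.comap_generateFrom]
      refine MeasurableSpace.generateFrom_le ?_
      rintro _ ⟨T, hT, rfl⟩
      have : Countable D := hD.to_subtype
      -- A box constrains every coordinate up to `k`. The earlier coordinates are freed by a
      -- countable union over all choices of sides from the cover `D`.
      have hcov : (fun z : ℕ → α => z k) ⁻¹' T = ⋃ d : Fin k → D,
          {z | ∀ i ≤ k, z i ∈ if hi : i < k then (d ⟨i, hi⟩ : Set α) else T} := by
        ext z
        simp only [Set.mem_preimage, Set.mem_iUnion, Set.mem_ofPred_eq]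
        constructor
        · intro hz
          have : ∀ i : Fin k, ∃ d : D, z i ∈ (d : Set α) := fun i => by
            have : z i ∈ ⋃₀ D := hDu ▸ Set.mem_univ _
            obtain ⟨d, hd, hz⟩ := this
            exact ⟨⟨d, hd⟩, hz⟩
          choose d hd using this
          refine ⟨d, fun i hi => ?_⟩
          split_ifs with h'
          · exact hd ⟨i, h'⟩
          · have : i = k := by omega
            exact this ▸ hz
        · rintro ⟨d, hd⟩
          simpa using hd k le_rfl
      rw [hcov]
      refine MeasurableSet.iUnion fun d => MeasurableSpace.measurableSet_generateFrom ?_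
      refine ⟨k, _, fun i => ?_, rfl⟩
      split_ifs with hi
      · exact hDC (d _).2
      · exact hT
    · rintro _ ⟨n, S, hS, rfl⟩
      exact hbox n S hS
  refine ext_of_generate_finite 𝓑 hgen ?_ ?_ (by simp)
  · rintro _ ⟨n, S, hS, rfl⟩ _ ⟨n', S', hS', rfl⟩ ⟨z, hz, hz'⟩
    -- Beyond both lengths the side is irrelevant but must still belong to `C`; `T₀` serves there.
    refine ⟨max n n', fun k => if k ≤ n then (if k ≤ n' then S k ∩ S' k else S k)
      else (if k ≤ n' then S' k else T₀), fun k => ?_, ?_⟩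
    · simp only
      split_ifs with h1 h2 h2
      · exact hpi _ (hS k) _ (hS' k) ⟨z k, hz k h1, hz' k h2⟩
      · exact hS k
      · exact hS' k
      · exact hDC hT₀
    · ext y
      simp only [Set.mem_inter_iff, Set.mem_ofPred_eq]
      constructor
      · rintro ⟨h1, h2⟩ k hk
        split_ifs with a b b
        · exact ⟨h1 k a, h2 k b⟩
        · exact h1 k a
        · exact h2 k b
        · omega
      · intro hy
        constructor
        · intro k hk
          have := hy k (le_max_of_le_left hk)
          rw [if_pos hk] at this
          split_ifs at this
          · exact this.1
          · exact this
        · intro k hk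
          have := hy k (le_max_of_le_right hk)
          rw [if_pos hk, if_pos hk] at this
          split_ifs at this
          · exact this.2
          · exact this
  · rintro _ ⟨n, S, hS, rfl⟩
    exact h n S hS

/-- Sequences that are `o(n)` stay so when sampled at slower times. -/
theorem tendsto_comp_div_of_le {a : ℕ → ℝ} (ha : Tendsto (fun n : ℕ => a n / n) atTop (𝓝 0))
    (ha0 : a 0 = 0) {c : ℕ → ℕ} (hc : ∀ N, c N ≤ N) :
    Tendsto (fun N : ℕ => a (c N) / N) atTop (𝓝 0) := by
  rw [Metric.tendsto_atTop] at ha ⊢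
  intro ε hε
  obtain ⟨n₀, hn₀⟩ := ha (ε / 2) (half_pos hε)
  set C := ∑ n ∈ Finset.range n₀, |a n| with hC
  have hC0 : 0 ≤ C := Finset.sum_nonneg fun _ _ => abs_nonneg _
  have hb : ∀ n : ℕ, |a n| ≤ ε / 2 * n + C := by
    intro n
    rcases lt_or_ge n n₀ with h | h
    · have : |a n| ≤ C := Finset.single_le_sum (f := fun n => |a n|) (fun _ _ => abs_nonneg _)
        (Finset.mem_range.2 h)
      have h2 : 0 ≤ ε / 2 * n := by positivity
      linarith
    -- At `n = 0` the quotient is `0` by convention and says nothing about `a 0`, hence `ha0`.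
    · rcases Nat.eq_zero_or_pos n with rfl | hn
      · rw [ha0]; simpa using hC0
      have := hn₀ n h
      rw [Real.dist_eq, sub_zero, abs_div, Nat.abs_cast, div_lt_iff₀ (by positivity)] at this
      linarith
  obtain ⟨N₀, hN₀⟩ := exists_nat_gt (2 * C / ε)
  refine ⟨N₀ + 1, fun N hN => ?_⟩
  have hNpos : (0 : ℝ) < N := by exact_mod_cast (by omega : 0 < N)
  rw [Real.dist_eq, sub_zero, abs_div, Nat.abs_cast, div_lt_iff₀ hNpos]
  have h1 := hb (c N)
  have h2 : (c N : ℝ) ≤ N := by exact_mod_cast hc N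
  have h3 : (N₀ : ℝ) < N := by exact_mod_cast (by omega : N₀ < N)
  have h4 : 2 * C < ε * N := by
    rw [div_lt_iff₀ hε] at hN₀
    nlinarith
  nlinarith

/-! ### Building a path from stacks of cards -/

section Stacks

variable {V E β : Type*}

/-- The states of an automaton that reads the letters of `w`. -/
def stateSeq (init : V → E) (next : E → V → E) (w : ℕ → V) : ℕ → E
  | 0 => init (w 0)
  | k + 1 => next (stateSeq init next w k) (w (k + 1))

theorem stateSeq_congr (init : V → E) (next : E → V → E) {w w' : ℕ → V} {n : ℕ}
    (h : ∀ k ≤ n, w k = w' k) : stateSeq init next w n = stateSeq init next w' n := by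
  induction n with
  | zero => simp [stateSeq, h 0 le_rfl]
  | succ n ih => simp [stateSeq, h (n + 1) le_rfl, ih fun k hk => h k (by omega)]

variable [DecidableEq E]

/-- How often the state `e` occurs before time `n`. -/
def visits (s : ℕ → E) (n : ℕ) (e : E) : ℕ := ((Finset.range n).filter fun i => s i = e).card

theorem visits_succ (s : ℕ → E) (n : ℕ) (e : E) :
    visits s (n + 1) e = visits s n e + if s n = e then 1 else 0 := by
  unfold visits
  rw [Finset.range_add_one, Finset.filter_insert]
  split_ifs with h
  · rw [Finset.card_insert_of_notMem (by simp)]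
  · rfl

theorem visits_le (s : ℕ → E) (n : ℕ) (e : E) : visits s n e ≤ n :=
  (Finset.card_filter_le _ _).trans (Finset.card_range n).le

theorem visits_mono (s : ℕ → E) (e : E) : Monotone fun n => visits s n e :=
  monotone_nat_of_le_succ fun n => by rw [visits_succ]; omega

theorem visits_congr {s s' : ℕ → E} {n : ℕ} (h : ∀ k < n, s k = s' k) (e : E) :
    visits s n e = visits s' n e := by
  unfold visits
  congr 1
  refine Finset.filter_congr fun k hk => ?_
  rw [h k (Finset.mem_range.1 hk)]

/-- The index of the card that is drawn at time `n`, if the state sequence is `s`: it comes from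
the stack of the current state, from which one card was drawn at each earlier visit. -/
def cardIndex (s : ℕ → E) : ℕ → Option (E × ℕ)
  | 0 => none
  | n + 1 => some (s n, visits s n (s n))

/-- No card is used twice: a second draw at the same state comes after the visit counter of that
state has increased. This is the source of independence along a fixed path. -/
theorem cardIndex_injective (s : ℕ → E) : Function.Injective (cardIndex s) := by
  have key : ∀ m n, m < n → cardIndex s (m + 1) ≠ cardIndex s (n + 1) := by
    intro m n hmn h
    simp only [cardIndex, Option.some.injEq, Prod.mk.injEq] at h
    have h1 := visits_succ s m (s m)
    rw [if_pos rfl] at h1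
    have h2 := visits_mono s (s m) (Nat.succ_le_of_lt hmn)
    simp only [Nat.succ_eq_add_one] at h2
    rw [← h.1] at h
    omega
  intro m n h
  rcases m with _ | m <;> rcases n with _ | n
  · rfl
  · simp [cardIndex] at h
  · simp [cardIndex] at h
  · rcases lt_trichotomy m n with h' | h' | h'
    · exact absurd h (key m n h')
    · rw [h']
    · exact absurd h.symm (key n m h')

theorem cardIndex_congr {s s' : ℕ → E} {n : ℕ} (h : ∀ k < n, s k = s' k) :
    cardIndex s n = cardIndex s' n := by
  cases n with
  | zero => rfl
  | succ n =>
    simp only [cardIndex]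
    rw [h n (Nat.lt_succ_self n), visits_congr fun k hk => h k (by omega)]

/-- The last card drawn, the state and the numbers of used cards after `n` draws. -/
def stackRun (init : V → E) (next : E → V → E) (ω : Option (E × ℕ) → V × β) :
    ℕ → (V × β) × E × (E → ℕ)
  | 0 => (ω none, init (ω none).1, fun _ => 0)
  | n + 1 =>
    let r := stackRun init next ω n
    let c := ω (some (r.2.1, r.2.2 r.2.1))
    (c, next r.2.1 c.1, fun e => r.2.2 e + if r.2.1 = e then 1 else 0)

/-- The sequence of cards drawn from the stacks `ω`. -/
def drawn (init : V → E) (next : E → V → E) (ω : Option (E × ℕ) → V × β) (n : ℕ) : V × β :=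
  (stackRun init next ω n).1

/-- The recursion carries its own state and counters; they can be recovered from the drawn nodes
alone, which lets the path be treated as a function of nodes. -/
theorem stackRun_snd (init : V → E) (next : E → V → E) (ω : Option (E × ℕ) → V × β) (n : ℕ) :
    (stackRun init next ω n).2 =
      (stateSeq init next (fun k => (drawn init next ω k).1) n,
        visits (stateSeq init next (fun k => (drawn init next ω k).1)) n) := by
  induction n with
  | zero => rfl
  | succ n ih =>
    have h1 : (stackRun init next ω n).2.1 = _ := congrArg Prod.fst ih
    have h2 : (stackRun init next ω n).2.2 = _ := congrArg Prod.snd ih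
    refine Prod.ext ?_ ?_
    · change next (stackRun init next ω n).2.1 (drawn init next ω (n + 1)).1 =
        next (stateSeq init next (fun k => (drawn init next ω k).1) n)
          (drawn init next ω (n + 1)).1
      rw [h1]
    · funext e
      change (stackRun init next ω n).2.2 e + (if (stackRun init next ω n).2.1 = e then 1 else 0) =
        visits (stateSeq init next fun k => (drawn init next ω k).1) (n + 1) e
      rw [h1, h2, visits_succ]

theorem drawn_eq (init : V → E) (next : E → V → E) (ω : Option (E × ℕ) → V × β) (n : ℕ) :
    drawn init next ω n =
      ω (cardIndex (stateSeq init next (fun k => (drawn init next ω k).1)) n) := by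
  cases n with
  | zero => rfl
  | succ n =>
    have h := stackRun_snd init next ω n
    change ω (some ((stackRun init next ω n).2.1,
      (stackRun init next ω n).2.2 (stackRun init next ω n).2.1)) = _
    rw [h]
    rfl

/-- As long as the drawn nodes follow `y`, the automaton is in the states determined by `y`. The
random card indices may therefore be replaced by deterministic ones. -/
theorem drawn_mem_box_iff (init : V → E) (next : E → V → E) (ω : Option (E × ℕ) → V × β)
    (y : ℕ → V) (S : ℕ → Set β) (n : ℕ) :
    (∀ k ≤ n, drawn init next ω k ∈ ({y k} : Set V) ×ˢ S k) ↔
      ∀ k ≤ n, ω (cardIndex (stateSeq init next y) k) ∈ ({y k} : Set V) ×ˢ S k := by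
  have key : ∀ n, (∀ k < n, (drawn init next ω k).1 = y k) →
      drawn init next ω n = ω (cardIndex (stateSeq init next y) n) := by
    intro n h
    rw [drawn_eq]
    congr 1
    exact cardIndex_congr fun k hk => stateSeq_congr _ _ fun i hi => h i (by omega)
  constructor
  · intro h k hk
    rw [← key k fun i hi => (h i (by omega)).1]
    exact h k hk
  · intro h k hk
    induction k using Nat.strong_induction_on with
    | _ k ih =>
      rw [key k fun i hi => (ih i hi (by omega)).1]
      exact h k hk

/-- The cards drawn at state `e` are the first ones of its stack, in order, so a sum over time
regroups into initial sums of the stacks. -/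
theorem sum_drawn [Fintype E] (init : V → E) (next : E → V → E) (ω : Option (E × ℕ) → V × β)
    (F : E → V × β → ℝ) (N : ℕ) :
    ∑ k ∈ Finset.range N, F (stateSeq init next (fun k => (drawn init next ω k).1) k)
        (drawn init next ω (k + 1)) =
      ∑ e, ∑ j ∈ Finset.range
        (visits (stateSeq init next (fun k => (drawn init next ω k).1)) N e),
          F e (ω (some (e, j))) := by
  set s := stateSeq init next (fun k => (drawn init next ω k).1) with hs
  induction N with
  | zero => simp [visits]
  | succ N ih =>
    rw [Finset.sum_range_succ, ih]
    have h1 : ∀ e, ∑ j ∈ Finset.range (visits s (N + 1) e), F e (ω (some (e, j))) =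
        ∑ j ∈ Finset.range (visits s N e), F e (ω (some (e, j))) +
          if s N = e then F e (ω (some (e, visits s N e))) else 0 := by
      intro e
      rw [visits_succ]
      split_ifs with h
      · rw [Finset.sum_range_succ]
      · simp
    simp only [h1, Finset.sum_add_distrib, Finset.sum_ite_eq, Finset.mem_univ, if_true]
    rw [drawn_eq init next ω (N + 1)]
    rfl

end Stacks

/-! ### Laws of large numbers for stacks and for drawn paths -/

section MarkovLLN

variable {V E β : Type*}

theorem measurable_stateSeq [MeasurableSpace V] [DiscreteMeasurableSpace V] [Countable V]
    [MeasurableSpace E] [DiscreteMeasurableSpace E] [Countable E]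
    (init : V → E) (next : E → V → E) (n : ℕ) :
    Measurable fun w : ℕ → V => stateSeq init next w n := by
  induction n with
  | zero => exact (Measurable.of_discrete (f := init)).comp (measurable_pi_apply 0)
  | succ n ih =>
    exact (Measurable.of_discrete (f := Function.uncurry next)).comp
      (ih.prodMk (measurable_pi_apply (n + 1)))

/-- Evaluation of a random coordinate is measurable. -/
theorem measurable_eval_of_countable {Ω ι α : Type*} [MeasurableSpace Ω] [MeasurableSpace α]
    [Countable ι] {i : Ω → ι} (hi : ∀ j, MeasurableSet {ω | i ω = j}) {f : ι → Ω → α}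
    (hf : ∀ j, Measurable (f j)) : Measurable fun ω => f (i ω) ω := by
  intro s hs
  have : (fun ω => f (i ω) ω) ⁻¹' s = ⋃ j, {ω | i ω = j} ∩ f j ⁻¹' s := by
    ext ω; simp
  rw [this]
  exact MeasurableSet.iUnion fun j => (hi j).inter (hf j hs)

variable [MeasurableSpace V] [MeasurableSpace β]

/-- The laws of the cards: the top card, and those in the stack of each state. -/
noncomputable def cardLaw (μ : Measure (V × β)) (ν : E → Measure (V × β)) :
    Option (E × ℕ) → Measure (V × β)
  | none => μ
  | some e => ν e.1

instance cardLaw.isProbabilityMeasure (μ : Measure (V × β)) (ν : E → Measure (V × β))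
    [IsProbabilityMeasure μ] [∀ e, IsProbabilityMeasure (ν e)] (i : Option (E × ℕ)) :
    IsProbabilityMeasure (cardLaw μ ν i) := by
  cases i <;> (unfold cardLaw; infer_instance)

variable (μ : Measure (V × β)) (ν : E → Measure (V × β)) [IsProbabilityMeasure μ]
  [∀ e, IsProbabilityMeasure (ν e)]

/-- Strong law of large numbers for the cards of one stack. -/
theorem stack_lln (e : E) {f : V × β → ℝ} (hf : Measurable f) (hfi : Integrable f (ν e)) :
    ∀ᵐ ω ∂(Measure.infinitePi (cardLaw μ ν)), Tendsto (fun n : ℕ =>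
      (∑ j ∈ Finset.range n, (f (ω (some (e, j))) - ∫ z, f z ∂(ν e))) / n) atTop (𝓝 0) := by
  have hmp : ∀ j : ℕ, MeasurePreserving (fun ω : Option (E × ℕ) → V × β => ω (some (e, j)))
      (Measure.infinitePi (cardLaw μ ν)) (ν e) := fun j =>
    measurePreserving_eval_infinitePi (cardLaw μ ν) (some (e, j))
  set c := ∫ z, f z ∂(ν e) with hc
  set g : V × β → ℝ := fun z => f z - c with hg
  have hmf : Measurable g := (hf).sub_const _
  have hif : Integrable g (ν e) := (hfi).sub (integrable_const _)
  have hmap : ∀ j : ℕ, Measure.map (fun ω : Option (E × ℕ) → V × β => g (ω (some (e, j))))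
      (Measure.infinitePi (cardLaw μ ν)) = Measure.map g (ν e) := fun j => by
    rw [← (hmp j).map_eq, Measure.map_map hmf (hmp j).measurable]
    rfl
  have hind : iIndepFun (fun (i : Option (E × ℕ)) (ω : Option (E × ℕ) → V × β) => g (ω i))
      (Measure.infinitePi (cardLaw μ ν)) :=
    iIndepFun_infinitePi (P := cardLaw μ ν) (X := fun _ x => g x) fun _ => hmf
  have := strong_law_ae_real (μ := Measure.infinitePi (cardLaw μ ν))
    (fun (j : ℕ) ω => g (ω (some (e, j))))
    ((hmp 0).integrable_comp_of_integrable hif)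
    (fun i j hij => hind.indepFun (by simpa using hij))
    (fun j => ⟨(hmf.comp (measurable_pi_apply _)).aemeasurable,
      (hmf.comp (measurable_pi_apply _)).aemeasurable, (hmap j).trans (hmap 0).symm⟩)
  have h0 : ∫ ω, g (ω (some (e, 0))) ∂(Measure.infinitePi (cardLaw μ ν)) = 0 := by
    have h1 : ∫ z, g z ∂(ν e) = 0 := by
      rw [hg, integral_sub (hfi) (integrable_const _)]
      simp [hc]
    rw [← h1, ← (hmp 0).map_eq, integral_map (hmp 0).measurable.aemeasurable
      hmf.aestronglyMeasurable]
  rwa [h0] at this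

variable [DecidableEq E]

theorem measurable_stackRun [DiscreteMeasurableSpace V] [Countable V] [Finite E]
    (init : V → E) (next : E → V → E) (n : ℕ) :
    Measurable (fun ω : Option (E × ℕ) → V × β => (stackRun init next ω n).1) ∧
      (∀ e, MeasurableSet {ω : Option (E × ℕ) → V × β | (stackRun init next ω n).2.1 = e}) ∧
      ∀ e, Measurable fun ω : Option (E × ℕ) → V × β => (stackRun init next ω n).2.2 e := by
  -- The statement mentions no `σ`-algebra on the finite set `E`, so the discrete one may be chosen.
  let _ : MeasurableSpace E := ⊤
  have hE : DiscreteMeasurableSpace E := ⟨fun _ => trivial⟩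
  suffices h : Measurable (fun ω : Option (E × ℕ) → V × β => (stackRun init next ω n).1) ∧
      Measurable (fun ω : Option (E × ℕ) → V × β => (stackRun init next ω n).2.1) ∧
      ∀ e, Measurable fun ω : Option (E × ℕ) → V × β => (stackRun init next ω n).2.2 e from
    ⟨h.1, fun e => h.2.1 (MeasurableSet.of_discrete (s := {e})), h.2.2⟩
  induction n with
  | zero =>
    refine ⟨measurable_pi_apply none, ?_, fun e => measurable_const⟩
    exact (Measurable.of_discrete (f := init)).comp (measurable_fst.comp (measurable_pi_apply none))
  | succ n ih =>
    obtain ⟨h1, h2, h3⟩ := ih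
    have hcount : Measurable fun ω : Option (E × ℕ) → V × β =>
        (stackRun init next ω n).2.2 (stackRun init next ω n).2.1 :=
      measurable_eval_of_countable (f := fun e ω => (stackRun init next ω n).2.2 e)
        (fun e => h2 (MeasurableSet.of_discrete (s := {e}))) h3
    have hc : Measurable fun ω : Option (E × ℕ) → V × β =>
        ω (some ((stackRun init next ω n).2.1,
          (stackRun init next ω n).2.2 (stackRun init next ω n).2.1)) :=
      measurable_eval_of_countable (f := fun (p : E × ℕ) ω => ω (some p))
        (i := fun ω => ((stackRun init next ω n).2.1,
          (stackRun init next ω n).2.2 (stackRun init next ω n).2.1))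
        (fun p => (h2.prodMk hcount) (MeasurableSet.of_discrete (s := {p})))
        (fun p => measurable_pi_apply _)
    refine ⟨hc, ?_, fun e => ?_⟩
    · exact (Measurable.of_discrete (f := Function.uncurry next)).comp
        (h2.prodMk (measurable_fst.comp hc))
    · exact (h3 e).add ((Measurable.of_discrete (f := fun e' : E => if e' = e then 1 else 0)).comp h2)

theorem measurable_drawn [DiscreteMeasurableSpace V] [Countable V] [Finite E]
    (init : V → E) (next : E → V → E) (n : ℕ) :
    Measurable (fun ω : Option (E × ℕ) → V × β => drawn init next ω n) :=
  (measurable_stackRun init next n).1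

/-- Along a prescribed path the card indices are deterministic and distinct, so the constraints are
independent and the probability factors. -/
theorem drawn_law [DiscreteMeasurableSpace V] [Countable V]
    (init : V → E) (next : E → V → E) (y : ℕ → V) (S : ℕ → Set β)
    (hS : ∀ k, MeasurableSet (S k)) (n : ℕ) :
    Measure.infinitePi (cardLaw μ ν)
        {ω | ∀ k ≤ n, drawn init next ω k ∈ ({y k} : Set V) ×ˢ S k} =
      μ ({y 0} ×ˢ S 0) * ∏ k ∈ Finset.range n,
        ν (stateSeq init next y k) ({y (k + 1)} ×ˢ S (k + 1)) := by
  set g := cardIndex (stateSeq init next y) with hg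
  have hm : ∀ k, MeasurableSet (({y k} : Set V) ×ˢ S k) := fun k =>
    MeasurableSet.of_discrete.prod (hS k)
  have hind : iIndepFun (fun (k : ℕ) (ω : Option (E × ℕ) → V × β) => ω (g k))
      (Measure.infinitePi (cardLaw μ ν)) :=
    (iIndepFun_infinitePi (P := cardLaw μ ν) (X := fun _ x => x) fun _ => measurable_id).precomp
      (cardIndex_injective _)
  have hset : {ω : Option (E × ℕ) → V × β | ∀ k ≤ n,
      drawn init next ω k ∈ ({y k} : Set V) ×ˢ S k} =
      ⋂ k ∈ Finset.range (n + 1), (fun ω => ω (g k)) ⁻¹' (({y k} : Set V) ×ˢ S k) := by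
    ext ω
    rw [Set.mem_ofPred_eq, drawn_mem_box_iff]
    simp [hg]
  rw [hset, hind.measure_inter_preimage_eq_mul _ (fun k _ => hm k), Finset.prod_range_succ', mul_comm]
  have h1 : ∀ k, Measure.infinitePi (cardLaw μ ν)
      ((fun ω => ω (g k)) ⁻¹' (({y k} : Set V) ×ˢ S k)) =
      cardLaw μ ν (g k) (({y k} : Set V) ×ˢ S k) := fun k =>
    (measurePreserving_eval_infinitePi (cardLaw μ ν) (g k)).measure_preimage
      (hm k).nullMeasurableSet
  rw [h1]
  congr 1
  exact Finset.prod_congr rfl fun k _ => h1 (k + 1)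

/-- Strong law of large numbers for the cards drawn from the stacks. -/
theorem drawn_lln [Fintype E] (init : V → E) (next : E → V → E) (f : E → V × β → ℝ)
    (hf : ∀ e, Measurable (f e)) (hfi : ∀ e, Integrable (f e) (ν e)) :
    ∀ᵐ ω ∂(Measure.infinitePi (cardLaw μ ν)), Tendsto (fun N : ℕ =>
      (∑ k ∈ Finset.range N,
        (f (stateSeq init next (fun k => (drawn init next ω k).1) k) (drawn init next ω (k + 1)) -
          ∫ z, f (stateSeq init next (fun k => (drawn init next ω k).1) k) z
            ∂(ν (stateSeq init next (fun k => (drawn init next ω k).1) k)))) / N)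
      atTop (𝓝 0) := by
  filter_upwards [ae_all_iff.2 fun e => stack_lln μ ν e (hf e) (hfi e)] with ω hω
  -- Each stack is read to a random depth of at most `N`. The i.i.d. sums are `o(n)` along all `n`,
  -- so evaluating them at that depth keeps them `o(N)`, even if the state is visited only finitely
  -- often.
  have h1 : Tendsto (fun N : ℕ => ∑ e, (∑ j ∈ Finset.range
        (visits (stateSeq init next (fun k => (drawn init next ω k).1)) N e),
          (f e (ω (some (e, j))) - ∫ z, f e z ∂(ν e))) / (N : ℝ)) atTop (𝓝 (∑ _ : E, 0)) :=
    tendsto_finsetSum _ fun e _ =>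
      tendsto_comp_div_of_le (hω e) (by simp) fun N => visits_le _ _ _
  rw [Finset.sum_const_zero] at h1
  refine h1.congr fun N => ?_
  rw [← Finset.sum_div, ← sum_drawn init next ω (fun e c => f e c - ∫ z, f e z ∂(ν e)) N]

end MarkovLLN

/-! ### Transfer of the law of large numbers to any process with the same path law -/

theorem generateFrom_range_singleton {V : Type*} [mV : MeasurableSpace V]
    [DiscreteMeasurableSpace V] [Countable V] :
    mV = MeasurableSpace.generateFrom (Set.range fun v : V => ({v} : Set V)) := by
  refine le_antisymm ?_ (MeasurableSpace.generateFrom_le fun _ _ => MeasurableSet.of_discrete)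
  intro s _
  rw [← Set.biUnion_of_singleton s]
  exact MeasurableSet.biUnion s.to_countable fun v _ =>
    MeasurableSpace.measurableSet_generateFrom ⟨v, rfl⟩

theorem isPiSystem_range_singleton (V : Type*) :
    IsPiSystem (Set.range fun v : V => ({v} : Set V)) := by
  rintro _ ⟨v, rfl⟩ _ ⟨w, rfl⟩ ⟨x, hx, hx'⟩
  have h1 : x = v := hx
  have h2 : x = w := hx'
  exact ⟨v, by simp [← h1, ← h2]⟩

section MarkovLLN

variable {V E β : Type*} [MeasurableSpace V] [DiscreteMeasurableSpace V] [Countable V]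
  [MeasurableSpace β]

/-- Two probability measures on sequences in `V × β`, with `V` countable, agree if they agree on
the boxes that prescribe the first components. -/
theorem measure_ext_of_path_boxes {μ ν : Measure (ℕ → V × β)} [IsProbabilityMeasure μ]
    [IsProbabilityMeasure ν]
    (h : ∀ (n : ℕ) (y : ℕ → V) (S : ℕ → Set β), (∀ k, MeasurableSet (S k)) →
      μ {z | ∀ k ≤ n, z k ∈ ({y k} : Set V) ×ˢ S k} =
        ν {z | ∀ k ≤ n, z k ∈ ({y k} : Set V) ×ˢ S k}) : μ = ν := by
  set C₁ : Set (Set V) := Set.range fun v : V => ({v} : Set V) with hC₁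
  set C₂ : Set (Set β) := {s | MeasurableSet s} with hC₂
  have hcount : C₁.Countable := Set.countable_range _
  have hgen₁ : MeasurableSpace.generateFrom C₁ = (inferInstance : MeasurableSpace V) :=
    generateFrom_range_singleton.symm
  have hspan₂ : IsCountablySpanning C₂ := ⟨fun _ => Set.univ, fun _ => MeasurableSet.univ,
    Set.iUnion_const _⟩
  rcases isEmpty_or_nonempty V with hV | hV
  · have h1 : μ Set.univ = 1 := measure_univ
    rw [Set.univ_eq_empty_iff.2 inferInstance, measure_empty] at h1
    exact absurd h1 zero_ne_one
  have hspan₁ : IsCountablySpanning C₁ := by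
    obtain ⟨u, hu⟩ := exists_surjective_nat V
    refine ⟨fun n => {u n}, fun n => ⟨u n, rfl⟩, ?_⟩
    ext v
    obtain ⟨n, rfl⟩ := hu v
    simp only [Set.mem_iUnion, Set.mem_singleton_iff, Set.mem_univ, iff_true]
    exact ⟨n, rfl⟩
  refine measure_ext_of_boxes (C := Set.image2 (· ×ˢ ·) C₁ C₂)
    (D := (fun s : Set V => s ×ˢ (Set.univ : Set β)) '' C₁) ?_ ?_ ?_ (hcount.image _) ?_ ?_
  · exact (generateFrom_eq_prod hgen₁ MeasurableSpace.generateFrom_measurableSet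
      hspan₁ hspan₂).symm
  · exact IsPiSystem.prod (isPiSystem_range_singleton V) MeasurableSpace.isPiSystem_measurableSet
  · rintro _ ⟨s, hs, rfl⟩
    exact ⟨s, hs, Set.univ, MeasurableSet.univ, rfl⟩
  · ext z
    simp [hC₁]
  · intro n S hS
    choose s hs t ht hst using hS
    choose y hy using hs
    have : ∀ k, S k = ({y k} : Set V) ×ˢ t k := fun k => by rw [← hst k, ← hy k]
    simp only [this]
    exact h n y t ht

/-- **Strong law of large numbers** along a path: `Z 0, Z 1, …` are random elements of `V × β`,
an automaton with finitely many states reads their first components, and given the past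
`Z (n + 1)` has the law `ν e`, where `e` is the current state of the automaton. -/
theorem path_lln [Fintype E] [DecidableEq E] (init : V → E) (next : E → V → E)
    (μ : Measure (V × β)) (ν : E → Measure (V × β)) [IsProbabilityMeasure μ]
    [∀ e, IsProbabilityMeasure (ν e)]
    {Ω : Type*} [MeasurableSpace Ω] (P : Measure Ω) [IsProbabilityMeasure P]
    (Z : ℕ → Ω → V × β) (hZ : ∀ n, Measurable (Z n))
    (hlaw : ∀ (n : ℕ) (y : ℕ → V) (S : ℕ → Set β), (∀ k, MeasurableSet (S k)) →
      P {ω | ∀ k ≤ n, Z k ω ∈ ({y k} : Set V) ×ˢ S k} =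
        μ ({y 0} ×ˢ S 0) * ∏ k ∈ Finset.range n,
          ν (stateSeq init next y k) ({y (k + 1)} ×ˢ S (k + 1)))
    (f : E → V × β → ℝ) (hf : ∀ e, Measurable (f e)) (hfi : ∀ e, Integrable (f e) (ν e)) :
    ∀ᵐ ω ∂P, Tendsto (fun N : ℕ =>
      (∑ k ∈ Finset.range N,
        (f (stateSeq init next (fun k => (Z k ω).1) k) (Z (k + 1) ω) -
          ∫ z, f (stateSeq init next (fun k => (Z k ω).1) k) z
            ∂(ν (stateSeq init next (fun k => (Z k ω).1) k)))) / N)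
      atTop (𝓝 0) := by
  let _ : MeasurableSpace E := ⊤
  have hE : DiscreteMeasurableSpace E := ⟨fun _ => trivial⟩
  have hmZ : Measurable fun ω k => Z k ω := measurable_pi_lambda _ hZ
  have hmd : Measurable fun (ω : Option (E × ℕ) → V × β) k => drawn init next ω k :=
    measurable_pi_lambda _ fun k => measurable_drawn init next k
  have hbox : ∀ (n : ℕ) (y : ℕ → V) (S : ℕ → Set β), (∀ k, MeasurableSet (S k)) →
      MeasurableSet {z : ℕ → V × β | ∀ k ≤ n, z k ∈ ({y k} : Set V) ×ˢ S k} := fun n y S hS => by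
    have : {z : ℕ → V × β | ∀ k ≤ n, z k ∈ ({y k} : Set V) ×ˢ S k} =
        ⋂ k, ⋂ (_ : k ≤ n), (fun z => z k) ⁻¹' (({y k} : Set V) ×ˢ S k) := by
      ext; simp
    rw [this]
    exact MeasurableSet.iInter fun k => MeasurableSet.iInter fun _ =>
      (measurable_pi_apply k) (MeasurableSet.of_discrete.prod (hS k))
  have hp1 : IsProbabilityMeasure (P.map fun ω k => Z k ω) :=
    Measure.isProbabilityMeasure_map hmZ.aemeasurable
  have hp2 : IsProbabilityMeasure ((Measure.infinitePi (cardLaw μ ν)).map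
      fun (ω : Option (E × ℕ) → V × β) k => drawn init next ω k) :=
    Measure.isProbabilityMeasure_map hmd.aemeasurable
  have heq : P.map (fun ω k => Z k ω) = (Measure.infinitePi (cardLaw μ ν)).map
      fun (ω : Option (E × ℕ) → V × β) k => drawn init next ω k := by
    refine measure_ext_of_path_boxes fun n y S hS => ?_
    rw [Measure.map_apply hmZ (hbox n y S hS), Measure.map_apply hmd (hbox n y S hS)]
    exact (hlaw n y S hS).trans (drawn_law μ ν init next y S hS n).symm
  have hms : ∀ k, Measurable fun z : ℕ → V × β => stateSeq init next (fun k => (z k).1) k :=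
    fun k => (measurable_stateSeq init next k).comp
      (measurable_pi_lambda _ fun k => measurable_fst.comp (measurable_pi_apply k))
  -- Convergence is a measurable event on path space, so its probability depends only on the common
  -- law `heq`.
  have hset : MeasurableSet {z : ℕ → V × β | Tendsto (fun N : ℕ =>
      (∑ k ∈ Finset.range N, (f (stateSeq init next (fun k => (z k).1) k) (z (k + 1)) -
        ∫ z', f (stateSeq init next (fun k => (z k).1) k) z'
          ∂(ν (stateSeq init next (fun k => (z k).1) k)))) / (N : ℝ)) atTop (𝓝 0)} := by
    refine measurableSet_tendsto (𝓝 0) fun N => ?_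
    refine (Finset.measurable_sum _ fun k _ => ?_).div_const _
    exact measurable_eval_of_countable
      (i := fun z : ℕ → V × β => stateSeq init next (fun k => (z k).1) k)
      (f := fun e z => f e (z (k + 1)) - ∫ z', f e z' ∂(ν e))
      (fun e => hms k (MeasurableSet.of_discrete (s := {e})))
      fun e => ((hf e).comp (measurable_pi_apply _)).sub_const _
  have h := (ae_map_iff hmd.aemeasurable hset).2 (drawn_lln μ ν init next f hf hfi)
  rw [← heq] at h
  exact (ae_map_iff hmZ.aemeasurable hset).1 h

end MarkovLLN

/-! ### The joint law of the next node and the holding time -/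

namespace JumpNetwork

variable {V : Type*} (G : JumpNetwork V)

theorem measurable_tail {x y : V} (h : G.Adj x y) : Measurable (G.tail x y) := by
  -- An indicator moves the moving endpoint into the integrand, so the tail is a parameter integral
  -- of a jointly measurable function.
  have h1 : StronglyMeasurable (Function.uncurry fun t u : ℝ =>
      (Set.Ioi t).indicator (G.ψ x y) u) := by
    refine Measurable.stronglyMeasurable ?_
    have : (Function.uncurry fun t u : ℝ => (Set.Ioi t).indicator (G.ψ x y) u) =
        {z : ℝ × ℝ | z.1 < z.2}.indicator fun z => G.ψ x y z.2 := by
      ext ⟨t, u⟩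
      simp [Function.uncurry, Set.indicator]
    rw [this]
    exact ((G.measurable_ψ x y h).comp measurable_snd).indicator
      (measurableSet_lt measurable_fst measurable_snd)
  have h2 : G.tail x y = fun t => ∫ u, (Set.Ioi t).indicator (G.ψ x y) u := by
    ext t
    rw [tail, integral_indicator measurableSet_Ioi]
  rw [h2]
  exact (StronglyMeasurable.integral_prod_right h1).measurable

theorem tail_nonneg {x y : V} (h : G.Adj x y) {t : ℝ} (ht : 0 ≤ t) : 0 ≤ G.tail x y t :=
  setIntegral_nonneg measurableSet_Ioi fun u hu => G.ψ_nonneg x y h u (lt_of_le_of_lt ht hu)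

variable [Fintype V]

theorem mem_nbr {x y : V} : y ∈ G.nbr x ↔ G.Adj x y := by simp [nbr]

theorem measurable_b (x y : V) : Measurable (G.b x y) := by
  classical
  unfold b
  by_cases h : G.Adj x y
  · simp only [if_pos h]
    exact (Finset.measurable_prod _ fun z hz =>
      G.measurable_tail (G.mem_nbr.1 (Finset.mem_of_mem_erase hz))).mul (G.measurable_ψ x y h)
  · simp only [if_neg h]
    exact measurable_const

theorem b_nonneg (x y : V) {t : ℝ} (ht : 0 < t) : 0 ≤ G.b x y t := by
  classical
  unfold b
  split_ifs with h
  · exact mul_nonneg (Finset.prod_nonneg fun z hz =>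
      G.tail_nonneg (G.mem_nbr.1 (Finset.mem_of_mem_erase hz)) ht.le) (G.ψ_nonneg x y h t ht)
  · exact le_rfl

/-- The system has left `x` by time `t` if and only if it has jumped to some node by then. -/
theorem sum_lintegral_b {x : V} (hx : ¬ G.IsSink x) {t : ℝ} (ht : 0 ≤ t) :
    ∑ y, ∫⁻ u in Set.Ioi t, ENNReal.ofReal (G.b x y u) = ENNReal.ofReal (G.a x t) := by
  classical
  have hne : (G.nbr x).Nonempty := by
    unfold IsSink at hx
    push Not at hx
    obtain ⟨y, hy⟩ := hx
    exact ⟨y, G.mem_nbr.2 hy⟩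
  set μ : V → Measure ℝ := fun y =>
    (volume.restrict (Set.Ioi (0 : ℝ))).withDensity (fun t => ENNReal.ofReal (G.ψ x y t)) with hμ
  have hint : ∀ y ∈ G.nbr x, IntegrableOn (G.ψ x y) (Set.Ioi 0) := fun y hy => by
    by_contra hcon
    have h := G.integral_ψ x y (G.mem_nbr.1 hy)
    rw [integral_undef hcon] at h
    exact zero_ne_one h
  have hμt : ∀ y ∈ G.nbr x, ∀ t, 0 ≤ t → μ y (Set.Ioi t) = ENNReal.ofReal (G.tail x y t) := by
    intro y hy t ht
    have hsub : Set.Ioi t ⊆ Set.Ioi (0 : ℝ) := Set.Ioi_subset_Ioi ht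
    rw [hμ]
    simp only
    rw [withDensity_apply _ measurableSet_Ioi, Measure.restrict_restrict measurableSet_Ioi,
      Set.inter_eq_left.2 hsub, tail, ofReal_integral_eq_lintegral_ofReal]
    · exact (hint y hy).mono_set hsub
    · exact (ae_restrict_mem measurableSet_Ioi).mono fun u hu =>
        G.ψ_nonneg x y (G.mem_nbr.1 hy) u (lt_of_le_of_lt ht hu)
  have hμ0 : ∀ y ∈ G.nbr x, μ y (Set.Ioi 0) = 1 := fun y hy => by
    rw [hμt y hy 0 le_rfl, tail, G.integral_ψ x y (G.mem_nbr.1 hy), ENNReal.ofReal_one]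
  have hμf : ∀ y ∈ G.nbr x, IsFiniteMeasure (μ y) := fun y hy =>
    ⟨by
      have : μ y Set.univ = μ y (Set.Ioi 0) := by
        simp [hμ, withDensity_apply _ measurableSet_Ioi]
      rw [this, hμ0 y hy]; exact ENNReal.one_lt_top⟩
  -- No clock rings before `t` exactly when the first ring, by whichever clock, comes after `t`.
  have key := first_of_clocks μ (G.nbr x) hne hμf (fun y _ => by rw [hμ]; infer_instance) t
  have hb : ∀ y ∈ G.nbr x, ∫⁻ u in Set.Ioi t, ENNReal.ofReal (G.b x y u) =
      ∫⁻ u in Set.Ioi t, ∏ j ∈ (G.nbr x).erase y, μ j (Set.Ioi u) ∂(μ y) := by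
    intro y hy
    have hmt : Measurable fun u => ∏ j ∈ (G.nbr x).erase y, μ j (Set.Ioi u) :=
      Finset.measurable_prod _ fun j _ => _root_.measurable_tail (μ j)
    rw [hμ]
    simp only
    rw [restrict_withDensity measurableSet_Ioi,
      lintegral_withDensity_eq_lintegral_mul _
        (G.measurable_ψ x y (G.mem_nbr.1 hy)).ennreal_ofReal hmt,
      Measure.restrict_restrict measurableSet_Ioi,
      Set.inter_eq_left.2 (Set.Ioi_subset_Ioi ht)]
    refine setLIntegral_congr_fun measurableSet_Ioi fun u hu => ?_
    have hu0 : 0 ≤ u := ht.trans (le_of_lt hu)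
    simp only [Pi.mul_apply, b, if_pos (G.mem_nbr.1 hy)]
    have hz0 : ∀ z ∈ (G.nbr x).erase y, 0 ≤ G.tail x z u := fun z hz =>
      G.tail_nonneg (G.mem_nbr.1 (Finset.mem_of_mem_erase hz)) hu0
    rw [mul_comm, mul_comm (ENNReal.ofReal _), ENNReal.ofReal_mul' (Finset.prod_nonneg hz0),
      ENNReal.ofReal_prod_of_nonneg hz0, mul_comm]
    congr 1
    exact Finset.prod_congr rfl fun z hz => (hμt z (Finset.mem_of_mem_erase hz) u hu0).symm
  rw [a, ENNReal.ofReal_prod_of_nonneg fun z hz => G.tail_nonneg (G.mem_nbr.1 hz) ht,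
    ← Finset.prod_congr rfl fun z hz => hμt z hz t ht, ← key, ← Finset.sum_congr rfl hb]
  refine (Finset.sum_subset (Finset.subset_univ _) fun y _ hy => ?_).symm
  have : ¬ G.Adj x y := fun h => hy (G.mem_nbr.2 h)
  simp [b, this]

theorem a_zero (x : V) : G.a x 0 = 1 :=
  Finset.prod_eq_one fun y hy => G.integral_ψ x y (G.mem_nbr.1 hy)

variable [MeasurableSpace V] [MeasurableSingletonClass V]

/-- The joint law of the next node and the holding time, for a system that has arrived at `x`. -/
noncomputable def jumpLaw (x : V) : Measure (V × ℝ) :=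
  ∑ y, (Measure.dirac y).prod
    ((volume.restrict (Set.Ioi (0 : ℝ))).withDensity fun u => ENNReal.ofReal (G.b x y u))

theorem jumpLaw_singleton_prod (x y : V) {S : Set ℝ} (hS : MeasurableSet S) :
    G.jumpLaw x ({y} ×ˢ S) = ∫⁻ u in Set.Ioi 0 ∩ S, ENNReal.ofReal (G.b x y u) := by
  classical
  have hsf : ∀ y, SFinite ((volume.restrict (Set.Ioi (0 : ℝ))).withDensity
      fun u => ENNReal.ofReal (G.b x y u)) := fun y => inferInstance
  rw [jumpLaw, Measure.finsetSum_apply, Finset.sum_eq_single y]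
  · rw [Measure.prod_prod, withDensity_apply _ hS, Measure.restrict_restrict hS, Set.inter_comm]
    simp
  · intro z _ hz
    rw [Measure.prod_prod]
    simp [hz]
  · simp

theorem jumpLaw_preimage_snd (x : V) {S : Set ℝ} (hS : MeasurableSet S) :
    G.jumpLaw x (Prod.snd ⁻¹' S) = ∑ y, ∫⁻ u in Set.Ioi 0 ∩ S, ENNReal.ofReal (G.b x y u) := by
  have h1 : (Prod.snd ⁻¹' S : Set (V × ℝ)) =
      ⋃ y ∈ (Finset.univ : Finset V), ({y} : Set V) ×ˢ S := by
    ext z; simp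
  rw [h1, measure_biUnion_finset]
  · exact Finset.sum_congr rfl fun y _ => G.jumpLaw_singleton_prod x y hS
  · intro y _ z _ hyz
    refine Set.disjoint_left.2 fun w hw hw' => hyz ?_
    exact (Set.mem_singleton_iff.1 hw.1).symm.trans (Set.mem_singleton_iff.1 hw'.1)
  · exact fun y _ => (measurableSet_singleton y).prod hS

theorem isProbabilityMeasure_jumpLaw {x : V} (hx : ¬ G.IsSink x) :
    IsProbabilityMeasure (G.jumpLaw x) := by
  refine ⟨?_⟩
  rw [← Set.preimage_univ (f := Prod.snd), G.jumpLaw_preimage_snd x MeasurableSet.univ,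
    Set.inter_univ, G.sum_lintegral_b hx le_rfl, G.a_zero, ENNReal.ofReal_one]

/-- The holding times are positive. -/
theorem ae_jumpLaw_pos (x : V) : ∀ᵐ z ∂(G.jumpLaw x), 0 < z.2 := by
  have h : {z : V × ℝ | ¬ 0 < z.2} = Prod.snd ⁻¹' Set.Iic (0 : ℝ) := by ext; simp
  have h2 : Set.Ioi 0 ∩ Set.Iic (0 : ℝ) = ∅ := by ext; simp
  rw [ae_iff, h, G.jumpLaw_preimage_snd x measurableSet_Iic, h2]
  simp

/-- The mean holding time is the mean of the holding time. -/
theorem lintegral_jumpLaw_snd {x : V} (hx : ¬ G.IsSink x) :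
    ∫⁻ z, ENNReal.ofReal z.2 ∂(G.jumpLaw x) = G.κ x := by
  -- Layer-cake formula: the probability that the holding time exceeds `t` is `a(t | x)`.
  rw [lintegral_eq_lintegral_meas_lt _ ((G.ae_jumpLaw_pos x).mono fun z hz => le_of_lt hz)
    measurable_snd.aemeasurable, κ]
  refine setLIntegral_congr_fun measurableSet_Ioi fun t ht => ?_
  have h : {z : V × ℝ | t < z.2} = Prod.snd ⁻¹' Set.Ioi t := by ext; simp
  change G.jumpLaw x {z | t < z.2} = ENNReal.ofReal (G.a x t)
  rw [h, G.jumpLaw_preimage_snd x measurableSet_Ioi,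
    Set.inter_eq_right.2 (Set.Ioi_subset_Ioi (le_of_lt ht)), G.sum_lintegral_b hx (le_of_lt ht)]

theorem setIntegral_b (x y : V) {S : Set ℝ} (hS : MeasurableSet S) :
    ∫ u in Set.Ioi 0 ∩ S, G.b x y u = (G.jumpLaw x).real ({y} ×ˢ S) := by
  rw [Measure.real, G.jumpLaw_singleton_prod x y hS,
    integral_eq_lintegral_of_nonneg_ae _ (G.measurable_b x y).aestronglyMeasurable]
  exact (ae_restrict_mem (measurableSet_Ioi.inter hS)).mono fun u hu => G.b_nonneg x y hu.1

theorem p_eq_jumpLaw_real {x : V} (hx : ¬ G.IsSink x) (y : V) :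
    G.p x y = (G.jumpLaw x).real ({y} ×ˢ Set.univ) := by
  rw [← G.setIntegral_b x y MeasurableSet.univ, p, if_neg hx, Set.inter_univ]

theorem integral_jumpLaw_fst {x : V} (hx : ¬ G.IsSink x) (g : V → ℝ) :
    ∫ z, g z.1 ∂(G.jumpLaw x) = ∑ y, G.p x y * g y := by
  have := G.isProbabilityMeasure_jumpLaw hx
  have hp : IsProbabilityMeasure ((G.jumpLaw x).map Prod.fst) :=
    Measure.isProbabilityMeasure_map measurable_fst.aemeasurable
  rw [← integral_map (φ := Prod.fst) (f := g) measurable_fst.aemeasurable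
    (Measurable.of_discrete.aestronglyMeasurable), integral_fintype Integrable.of_finite]
  refine Finset.sum_congr rfl fun y _ => ?_
  rw [G.p_eq_jumpLaw_real hx, map_measureReal_apply measurable_fst (measurableSet_singleton y),
    smul_eq_mul]
  congr 2
  ext z; simp

end JumpNetwork

/-! ### Hitting times as conditions on finitely many coordinates -/

section Hitting

variable {V : Type*}

theorem coe_lt_hitFrom_iff (w : ℕ → V) (S : Set V) (n : ℕ∞) (N : ℕ) :
    (N : ℕ∞) < hitFrom w S n ↔ ∀ l : ℕ, n ≤ l → w l ∈ S → N < l := by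
  constructor
  · intro h l hl hS
    have : hitFrom w S n ≤ l := iInf₂_le l ⟨hl, hS⟩
    exact_mod_cast h.trans_le this
  · intro h
    refine lt_of_lt_of_le (b := ((N + 1 : ℕ) : ℕ∞)) (by exact_mod_cast Nat.lt_succ_self N) ?_
    exact le_iInf₂ fun l hl => by exact_mod_cast h l hl.1 hl.2

theorem hitFrom_le_coe_iff (w : ℕ → V) (S : Set V) (n : ℕ∞) (N : ℕ) :
    hitFrom w S n ≤ N ↔ ∃ l ≤ N, n ≤ (l : ℕ∞) ∧ w l ∈ S := by
  rw [← not_lt, coe_lt_hitFrom_iff]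
  push Not
  exact ⟨fun ⟨l, h1, h2, h3⟩ => ⟨l, h3, h1, h2⟩, fun ⟨l, h1, h2, h3⟩ => ⟨l, h2, h3, h1⟩⟩

theorem hitFrom_lt_hitFrom_iff (w : ℕ → V) (A B : Set V) :
    hitFrom w B 0 < hitFrom w A 0 ↔ ∃ l, w l ∈ B ∧ ∀ i ≤ l, w i ∉ A := by
  constructor
  · intro h
    obtain ⟨l, hl⟩ := ENat.ne_top_iff_exists.1 (ne_top_of_lt h)
    rw [← hl, coe_lt_hitFrom_iff] at h
    refine ⟨l, hitFrom_mem w B 0 l hl.symm, fun i hi hA => ?_⟩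
    exact absurd (h i zero_le hA) (by omega)
  · rintro ⟨l, hB, hA⟩
    refine lt_of_le_of_lt ((hitFrom_le_coe_iff w B 0 l).2 ⟨l, le_rfl, zero_le, hB⟩) ?_
    rw [coe_lt_hitFrom_iff]
    intro i _ hi
    by_contra! h
    exact hA i h hi

/-- Forgetting a starting node outside `A ∪ B` lowers both hitting times by one. This yields
harmonicity of the committor. -/
theorem hitFrom_lt_hitFrom_shift (w : ℕ → V) {A B : Set V} (hA : w 0 ∉ A) (hB : w 0 ∉ B) :
    (hitFrom w B 0 < hitFrom w A 0) ↔
      hitFrom (fun n => w (n + 1)) B 0 < hitFrom (fun n => w (n + 1)) A 0 := by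
  rw [hitFrom_lt_hitFrom_iff, hitFrom_lt_hitFrom_iff]
  constructor
  · rintro ⟨l, hl, h⟩
    rcases l with _ | l
    · exact absurd hl hB
    · exact ⟨l, hl, fun i hi => h (i + 1) (by omega)⟩
  · rintro ⟨l, hl, h⟩
    refine ⟨l + 1, hl, fun i hi => ?_⟩
    rcases i with _ | i
    · exact hA
    · exact h i (by omega)

end Hitting

/-! ### The embedded chain and its committor -/

namespace JumpNetwork

variable {V : Type*} [Fintype V] (G : JumpNetwork V) [MeasurableSpace V]
  [MeasurableSingletonClass V]

theorem step_singleton (x y : V) : G.step x {y} = ENNReal.ofReal (G.p x y) := by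
  classical
  change (∑ z, ENNReal.ofReal (G.p x z) • Measure.dirac z) {y} = _
  rw [Measure.finsetSum_apply]
  simp [Set.indicator_apply]

instance (x : V) : IsProbabilityMeasure (G.chainLaw x) := by
  unfold chainLaw; infer_instance

open Classical in
theorem chainLaw_cylinder (x : V) (y : ℕ → V) (n : ℕ) :
    G.chainLaw x {w | ∀ k ≤ n, w k = y k} =
      (if y 0 = x then 1 else 0) *
        ∏ k ∈ Finset.range n, ENNReal.ofReal (G.p (y k) (y (k + 1))) := by
  induction n with
  | zero =>
    have h1 : {w : ℕ → V | ∀ k ≤ 0, w k = y k} =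
        (fun w => Preorder.frestrictLe (π := fun _ => V) 0 w) ⁻¹'
          {h | h ⟨0, Finset.mem_Iic.2 le_rfl⟩ = y 0} := by
      ext w; simp [Preorder.frestrictLe]
    have hms : MeasurableSet {h : (i : Finset.Iic 0) → V | h ⟨0, Finset.mem_Iic.2 le_rfl⟩ = y 0} :=
      MeasurableSet.of_discrete
    rw [h1, ← Measure.map_apply (Preorder.measurable_frestrictLe 0) hms, chainLaw,
      Kernel.trajMeasure, Measure.map_comp _ _ (Preorder.measurable_frestrictLe 0),
      Kernel.traj_map_frestrictLe, Kernel.partialTraj_self, Measure.id_comp,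
      Measure.map_apply (MeasurableEquiv.measurable _) hms,
      Measure.dirac_apply' _ ((MeasurableEquiv.measurable _) hms)]
    simp [Set.indicator_apply, eq_comm]
  | succ n ih =>
    have h1 : {w : ℕ → V | ∀ k ≤ n + 1, w k = y k} =
        (fun w => (Preorder.frestrictLe (π := fun _ => V) n w, w (n + 1))) ⁻¹'
          ({fun i : Finset.Iic n => y i} ×ˢ {y (n + 1)}) := by
      ext w
      simp only [Set.mem_ofPred_eq, Set.mem_preimage, Set.mem_prod, Set.mem_singleton_iff]
      constructor
      · intro h
        exact ⟨funext fun i => h i ((Finset.mem_Iic.1 i.2).trans (Nat.le_succ n)), h _ le_rfl⟩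
      · rintro ⟨h, h'⟩ k hk
        rcases Nat.le_succ_iff.1 hk with hk | rfl
        · exact congrFun h ⟨k, Finset.mem_Iic.2 hk⟩
        · exact h'
    have h2 : {w : ℕ → V | ∀ k ≤ n, w k = y k} =
        Preorder.frestrictLe (π := fun _ => V) n ⁻¹' {fun i : Finset.Iic n => y i} := by
      ext w
      simp only [Set.mem_ofPred_eq, Set.mem_preimage, Set.mem_singleton_iff]
      exact ⟨fun h => funext fun i => h i (Finset.mem_Iic.1 i.2),
        fun h k hk => congrFun h ⟨k, Finset.mem_Iic.2 hk⟩⟩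
    rw [h1, ← Measure.map_apply ((Preorder.measurable_frestrictLe n).prodMk
      (measurable_pi_apply (n + 1))) MeasurableSet.of_discrete]
    -- Disintegration of the trajectory measure: the next node is sampled by `step` from the last of
    -- the first `n + 1` nodes.
    have h3 := Kernel.map_frestrictLe_trajMeasure_compProd_eq_map_trajMeasure
      (X := fun _ => V) (μ₀ := Measure.dirac x) (a := n) (κ := fun n =>
        G.step.comap (fun h : (∀ _ : Finset.Iic n, V) => h ⟨n, Finset.mem_Iic.2 le_rfl⟩)
        (measurable_pi_apply _))
    change _ = Measure.map _ (G.chainLaw x) at h3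
    rw [← h3, Measure.compProd_apply_prod (measurableSet_singleton _) (measurableSet_singleton _),
      lintegral_singleton, Kernel.comap_apply]
    change G.step (y n) {y (n + 1)} * Measure.map _ (G.chainLaw x) _ = _
    rw [Measure.map_apply (Preorder.measurable_frestrictLe n) (measurableSet_singleton _), ← h2, ih,
      step_singleton, Finset.prod_range_succ]
    ring

theorem ae_chainLaw_zero (x : V) : ∀ᵐ w ∂(G.chainLaw x), w 0 = x := by
  have h := G.chainLaw_cylinder x (fun _ => x) 0
  simp only [nonpos_iff_eq_zero, forall_eq, if_true, Finset.range_zero, Finset.prod_empty,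
    mul_one] at h
  have hm : MeasurableSet {w : ℕ → V | w 0 = x} :=
    measurableSet_eq_fun (measurable_pi_apply 0) measurable_const
  exact (prob_compl_eq_zero_iff hm).2 h

/-- The Markov property of the embedded chain at time one. -/
theorem chainLaw_map_shift (x : V) :
    (G.chainLaw x).map (fun w n => w (n + 1)) =
      ∑ z, ENNReal.ofReal (G.p x z) • G.chainLaw z := by
  classical
  have hm : Measurable fun (w : ℕ → V) n => w (n + 1) :=
    measurable_pi_lambda _ fun n => measurable_pi_apply _
  have hp1 : IsProbabilityMeasure ((G.chainLaw x).map (fun w n => w (n + 1))) :=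
    Measure.isProbabilityMeasure_map hm.aemeasurable
  have hp2 : IsProbabilityMeasure (∑ z, ENNReal.ofReal (G.p x z) • G.chainLaw z) := ⟨by
    rw [Measure.finsetSum_apply]
    simp [← ENNReal.ofReal_sum_of_nonneg fun y _ => G.p_nonneg x y, G.sum_p x]⟩
  refine measure_ext_of_boxes (generateFrom_range_singleton (V := V))
    (isPiSystem_range_singleton V) subset_rfl (Set.countable_range _) ?_ fun n S hS => ?_
  · ext v; simp
  choose y hy using hS
  obtain rfl : (fun k => {y k}) = S := funext hy
  have hbox : MeasurableSet {z : ℕ → V | ∀ k ≤ n, z k = y k} := by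
    have : {z : ℕ → V | ∀ k ≤ n, z k = y k} = ⋂ k, ⋂ (_ : k ≤ n), (fun z => z k) ⁻¹' {y k} := by
      ext; simp
    rw [this]
    exact MeasurableSet.iInter fun k => MeasurableSet.iInter fun _ =>
      (measurable_pi_apply k) (measurableSet_singleton _)
  simp only [Set.mem_singleton_iff]
  rw [Measure.map_apply hm hbox, Measure.finsetSum_apply]
  -- With `x` prepended, the shifted cylinder becomes an ordinary one, up to the null event that the
  -- chain does not start at `x`.
  set y' : ℕ → V := fun k => Nat.casesOn k x y with hy'
  have h1 : G.chainLaw x ((fun w n => w (n + 1)) ⁻¹' {z : ℕ → V | ∀ k ≤ n, z k = y k}) =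
      G.chainLaw x {w | ∀ k ≤ n + 1, w k = y' k} := by
    refine measure_congr ((G.ae_chainLaw_zero x).mono fun w hw => ?_)
    refine propext ⟨fun h k hk => ?_, fun h k hk => h (k + 1) (by omega)⟩
    rcases k with _ | k
    · exact hw
    · exact h k (by omega)
  rw [h1, chainLaw_cylinder, Finset.prod_range_succ']
  simp only [Measure.smul_apply, chainLaw_cylinder, smul_eq_mul]
  simp only [ite_mul, mul_ite, mul_zero, zero_mul, one_mul, Finset.sum_ite_eq, Finset.mem_univ,
    if_true, hy']
  exact (if_pos rfl).trans (mul_comm _ _)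

theorem measurableSet_hitFrom_lt (A B : Set V) :
    MeasurableSet {w : ℕ → V | hitFrom w B 0 < hitFrom w A 0} := by
  have : {w : ℕ → V | hitFrom w B 0 < hitFrom w A 0} =
      ⋃ l, ((fun w => w l) ⁻¹' B ∩ ⋂ i, ⋂ (_ : i ≤ l), (fun w => w i) ⁻¹' Aᶜ) := by
    ext w
    simp [hitFrom_lt_hitFrom_iff]
  rw [this]
  exact MeasurableSet.iUnion fun l => ((measurable_pi_apply l) MeasurableSet.of_discrete).inter
    (MeasurableSet.iInter fun i => MeasurableSet.iInter fun _ =>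
      (measurable_pi_apply i) MeasurableSet.of_discrete)

theorem q_eq_zero {A B : Set V} {x : V} (hx : x ∈ A) : G.q A B x = 0 := by
  have : G.chainLaw x {w | hitFrom w B 0 < hitFrom w A 0} = 0 := by
    refine measure_eq_zero_iff_ae_notMem.2 ((G.ae_chainLaw_zero x).mono fun w hw h => ?_)
    obtain ⟨l, _, hl⟩ := (hitFrom_lt_hitFrom_iff w A B).1 h
    exact hl 0 (Nat.zero_le l) (hw ▸ hx)
  rw [q, Measure.real, this, ENNReal.toReal_zero]

theorem q_eq_one {A B : Set V} {x : V} (hx : x ∈ B) (hxA : x ∉ A) : G.q A B x = 1 := by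
  have : G.chainLaw x {w | hitFrom w B 0 < hitFrom w A 0} = G.chainLaw x Set.univ := by
    refine measure_congr ((G.ae_chainLaw_zero x).mono fun w hw => ?_)
    refine propext ⟨fun _ => trivial, fun _ => (hitFrom_lt_hitFrom_iff w A B).2
      ⟨0, hw ▸ hx, fun i hi => ?_⟩⟩
    obtain rfl : i = 0 := by omega
    exact hw ▸ hxA
  rw [q, Measure.real, this, measure_univ, ENNReal.toReal_one]

/-- The committor is harmonic off `A ∪ B`. -/
theorem q_harmonic {A B : Set V} {x : V} (hA : x ∉ A) (hB : x ∉ B) :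
    G.q A B x = ∑ y, G.p x y * G.q A B y := by
  have hm : Measurable fun (w : ℕ → V) n => w (n + 1) :=
    measurable_pi_lambda _ fun n => measurable_pi_apply _
  have h1 : G.chainLaw x {w | hitFrom w B 0 < hitFrom w A 0} =
      (G.chainLaw x).map (fun w n => w (n + 1)) {w | hitFrom w B 0 < hitFrom w A 0} := by
    rw [Measure.map_apply hm (measurableSet_hitFrom_lt A B)]
    refine measure_congr ((G.ae_chainLaw_zero x).mono fun w hw => ?_)
    exact propext (hitFrom_lt_hitFrom_shift w (hw ▸ hA) (hw ▸ hB))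
  rw [q, Measure.real, h1, chainLaw_map_shift, Measure.finsetSum_apply, ENNReal.toReal_sum]
  · refine Finset.sum_congr rfl fun y _ => ?_
    rw [Measure.smul_apply, smul_eq_mul, ENNReal.toReal_mul, ENNReal.toReal_ofReal (G.p_nonneg x y)]
    rfl
  · intro y _
    exact ENNReal.mul_ne_top ENNReal.ofReal_ne_top (measure_ne_top _ _)

end JumpNetwork

/-! ### Counting reactive pieces with a flag, and telescoping the committor -/

section Reactive

variable {V : Type*} {A B : Finset V}

open Classical in
/-- Update of the flag that records whether `A` was visited after the last visit to `B`. -/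
noncomputable def flag (A B : Finset V) (s : Bool) (x : V) : Bool :=
  if x ∈ A then true else if x ∈ B then false else s

/-- The initial state, and the transitions, of the automaton that carries the present node and
the flag. -/
noncomputable def flagInit (A B : Finset V) (x : V) : V × Bool := (x, flag A B false x)

/-- See `flagInit`. -/
noncomputable def flagNext (A B : Finset V) (e : V × Bool) (x : V) : V × Bool :=
  (x, flag A B e.2 x)

theorem stateSeq_flag_fst (w : ℕ → V) (n : ℕ) :
    (stateSeq (flagInit A B) (flagNext A B) w n).1 = w n := by
  cases n <;> rfl

theorem stateSeq_flag_succ (w : ℕ → V) (n : ℕ) :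
    (stateSeq (flagInit A B) (flagNext A B) w (n + 1)).2 =
      flag A B (stateSeq (flagInit A B) (flagNext A B) w n).2 (w (n + 1)) := rfl

theorem flag_of_mem_left {s : Bool} {x : V} (h : x ∈ A) : flag A B s x = true := by simp [flag, h]

theorem flag_of_mem_right (hAB : Disjoint A B) {s : Bool} {x : V} (h : x ∈ B) :
    flag A B s x = false := by
  simp [flag, h, Finset.disjoint_right.1 hAB h]

theorem flag_of_notMem {s : Bool} {x : V} (hA : x ∉ A) (hB : x ∉ B) : flag A B s x = s := by
  simp [flag, hA, hB]

open Classical in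
/-- The number of arrivals in `B` with the flag set, up to time `N`. -/
noncomputable def arrivals (A B : Finset V) (w : ℕ → V) (N : ℕ) : ℕ :=
  ((Finset.range N).filter fun k =>
    (stateSeq (flagInit A B) (flagNext A B) w k).2 = true ∧ w (k + 1) ∈ B).card

open Classical in
theorem arrivals_succ (w : ℕ → V) (N : ℕ) :
    arrivals A B w (N + 1) = arrivals A B w N +
      if (stateSeq (flagInit A B) (flagNext A B) w N).2 = true ∧ w (N + 1) ∈ B then 1 else 0 := by
  unfold arrivals
  rw [Finset.range_add_one, Finset.filter_insert]
  split_ifs with h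
  · rw [Finset.card_insert_of_notMem (by simp)]
  · rfl

theorem tauB_mono (w : ℕ → V) (A B : Set V) : Monotone (tauB w A B) :=
  monotone_nat_of_le_succ fun _ => (le_hitFrom _ _ _).trans (le_hitFrom _ _ _)

/-- The invariant of an induction on `N`: the flag tells whether the current cycle is waiting for
`B` or still for `A`. The second case must record that `A` has not yet been reached, which is more
than the bound on `τ_B` finally needed. -/
theorem arrivals_spec (hAB : Disjoint A B) (w : ℕ → V) (N : ℕ) :
    tauB w A B (arrivals A B w N) ≤ N ∧
      if (stateSeq (flagInit A B) (flagNext A B) w N).2 = true then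
        hitFrom w A (tauB w A B (arrivals A B w N)) ≤ N ∧
          (N : ℕ∞) < tauB w A B (arrivals A B w N + 1)
      else (N : ℕ∞) < hitFrom w A (tauB w A B (arrivals A B w N)) := by
  classical
  induction N with
  | zero =>
    have h0 : arrivals A B w 0 = 0 := by simp [arrivals]
    rw [h0]
    refine ⟨by simp [tauB], ?_⟩
    by_cases hA : w 0 ∈ A
    · have hs : (stateSeq (flagInit A B) (flagNext A B) w 0).2 = true := flag_of_mem_left hA
      rw [if_pos hs]
      refine ⟨(hitFrom_le_coe_iff _ _ _ _).2 ⟨0, le_rfl, by simp [tauB], hA⟩,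
        (coe_lt_hitFrom_iff _ _ _ _).2 fun l _ hB => ?_⟩
      rcases l with _ | l
      · exact absurd hB (Finset.disjoint_left.1 hAB hA)
      · omega
    · have hs : ¬ (stateSeq (flagInit A B) (flagNext A B) w 0).2 = true := by
        change ¬ flag A B false (w 0) = true
        simp [flag, hA]
      rw [if_neg hs]
      refine (coe_lt_hitFrom_iff _ _ _ _).2 fun l _ hl => ?_
      rcases l with _ | l
      · exact absurd hl hA
      · omega
  | succ N ih =>
    obtain ⟨ih1, ih2⟩ := ih
    rw [stateSeq_flag_succ, arrivals_succ]
    set R := arrivals A B w N with hR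
    set s := (stateSeq (flagInit A B) (flagNext A B) w N).2 with hs
    have hcast : (N : ℕ∞) ≤ ((N + 1 : ℕ) : ℕ∞) := by exact_mod_cast Nat.le_succ N
    rcases Bool.eq_false_or_eq_true s with hst | hst
    · rw [if_pos hst] at ih2
      obtain ⟨hU, hT⟩ := ih2
      have hT' := (coe_lt_hitFrom_iff _ _ _ _).1 hT
      by_cases hB : w (N + 1) ∈ B
      · rw [if_pos ⟨hst, hB⟩, flag_of_mem_right hAB hB, if_neg (by simp)]
        have hle : tauB w A B (R + 1) ≤ ((N + 1 : ℕ) : ℕ∞) :=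
          (hitFrom_le_coe_iff _ _ _ _).2 ⟨N + 1, le_rfl, hU.trans hcast, hB⟩
        refine ⟨hle, (coe_lt_hitFrom_iff _ _ _ _).2 fun l hl hA => ?_⟩
        have h1 : N < l := by exact_mod_cast hT.trans_le hl
        have h2 : l ≠ N + 1 := fun h => Finset.disjoint_left.1 hAB hA (h ▸ hB)
        omega
      · rw [if_neg fun h => hB h.2, add_zero]
        have hf : flag A B s (w (N + 1)) = true := by
          by_cases hA : w (N + 1) ∈ A
          · exact flag_of_mem_left hA
          · rw [flag_of_notMem hA hB, hst]
        rw [if_pos hf]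
        refine ⟨ih1.trans hcast, hU.trans hcast, (coe_lt_hitFrom_iff _ _ _ _).2 fun l hl hlB => ?_⟩
        have h1 := hT' l hl hlB
        have h2 : l ≠ N + 1 := fun h => hB (h ▸ hlB)
        omega
    · have hst' : ¬ s = true := by simp [hst]
      rw [if_neg hst'] at ih2
      rw [if_neg fun h => hst' h.1, add_zero]
      refine ⟨ih1.trans hcast, ?_⟩
      have hU' := (coe_lt_hitFrom_iff _ _ _ _).1 ih2
      by_cases hA : w (N + 1) ∈ A
      · rw [if_pos (flag_of_mem_left hA)]
        refine ⟨(hitFrom_le_coe_iff _ _ _ _).2 ⟨N + 1, le_rfl, ih1.trans hcast, hA⟩,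
          (coe_lt_hitFrom_iff _ _ _ _).2 fun l hl hlB => ?_⟩
        have h1 : N < l := by exact_mod_cast ih2.trans_le hl
        have h2 : l ≠ N + 1 := fun h => Finset.disjoint_left.1 hAB hA (h ▸ hlB)
        omega
      · have hf : ¬ flag A B s (w (N + 1)) = true := by
          simp [flag, hA, hst]
        rw [if_neg hf]
        refine (coe_lt_hitFrom_iff _ _ _ _).2 fun l hl hlA => ?_
        have h1 := hU' l hl hlA
        have h2 : l ≠ N + 1 := fun h => hA (h ▸ hlA)
        omega

/-- Both numbers place `N` between the same kind of consecutive `τ_B`, and `τ_B` is monotone, so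
neither can exceed the other. -/
theorem numReactive_eq_arrivals (hAB : Disjoint A B) (w : ℕ → V) (N : ℕ) :
    numReactive w (A : Set V) (B : Set V) N = arrivals A B w N := by
  obtain ⟨h1, h2⟩ := numReactive_spec w (Finset.disjoint_coe.2 hAB) N
  obtain ⟨h3, h4⟩ := arrivals_spec hAB w N
  have h5 : (N : ℕ∞) < tauB w A B (arrivals A B w N + 1) := by
    split_ifs at h4
    · exact h4.2
    · exact h4.trans_le (le_hitFrom _ _ _)
  have hmono := tauB_mono w (A : Set V) (B : Set V)
  have h6 := hmono.reflect_lt (h1.trans_lt h5)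
  have h7 := hmono.reflect_lt (h3.trans_lt h2)
  omega

/-- Telescoping the committor along the pieces of the path on which the flag is set. -/
theorem arrivals_eq_sum (hAB : Disjoint A B) (w : ℕ → V) {q r : V → ℝ}
    (hqA : ∀ x ∈ A, q x = 0) (hqB : ∀ x ∈ B, q x = 1)
    (hq : ∀ x, x ∉ A → x ∉ B → q x = r x) (N : ℕ) :
    (arrivals A B w N : ℝ) =
      ∑ k ∈ Finset.range N, ((if (stateSeq (flagInit A B) (flagNext A B) w k).2 = true
          then q (w (k + 1)) else 0) -
        (if (stateSeq (flagInit A B) (flagNext A B) w k).2 = true then r (w k) else 0)) +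
      ∑ k ∈ Finset.range N, (A : Set V).indicator r (w k) -
      (if (stateSeq (flagInit A B) (flagNext A B) w N).2 = true then q (w N) else 0) := by
  classical
  induction N with
  | zero =>
    have : (if (stateSeq (flagInit A B) (flagNext A B) w 0).2 = true then q (w 0) else 0) = 0 := by
      change (if flag A B false (w 0) = true then q (w 0) else 0) = 0
      by_cases hA : w 0 ∈ A
      · simp [hqA _ hA]
      · simp [flag, hA]
    rw [this]
    simp [arrivals]
  | succ N ih =>
    -- The flag at time `N` already accounts for `w N`, and updating twice with the same node
    -- changes nothing. So it is forced to be set on `A` and unset on `B`.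
    have hflag : (stateSeq (flagInit A B) (flagNext A B) w N).2 =
        flag A B (stateSeq (flagInit A B) (flagNext A B) w N).2 (w N) := by
      cases N with
      | zero =>
        change flag A B false (w 0) = flag A B (flag A B false (w 0)) (w 0)
        unfold flag
        split_ifs <;> rfl
      | succ N =>
        rw [stateSeq_flag_succ]
        unfold flag
        split_ifs <;> rfl
    rw [arrivals_succ, Nat.cast_add, ih, Finset.sum_range_succ, Finset.sum_range_succ,
      stateSeq_flag_succ]
    set s := (stateSeq (flagInit A B) (flagNext A B) w N).2 with hs
    -- Replacing `q` by `r` at the current node costs nothing off `A ∪ B`, nor on `B`, where the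
    -- flag is down; on `A`, where `q = 0`, it costs `r`.
    have h1 : (if s = true then q (w N) else 0) + (A : Set V).indicator r (w N) =
        if s = true then r (w N) else 0 := by
      by_cases hA : w N ∈ A
      · rw [flag_of_mem_left hA] at hflag
        simp [hflag, hA, hqA _ hA]
      · by_cases hB : w N ∈ B
        · rw [flag_of_mem_right hAB hB] at hflag
          simp [hflag, hA]
        · simp [hA, hq _ hA hB]
    -- An arrival in `B` clears the flag, and the value `q = 1` lost in this way is the counted
    -- unit. On `A` the flag may jump up, but `q = 0` there.
    have h2 : (if s = true then q (w (N + 1)) else 0) =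
        ((if s = true ∧ w (N + 1) ∈ B then 1 else 0 : ℕ) : ℝ) +
          if flag A B s (w (N + 1)) = true then q (w (N + 1)) else 0 := by
      by_cases hA : w (N + 1) ∈ A
      · simp [hqA _ hA, Finset.disjoint_left.1 hAB hA]
      · by_cases hB : w (N + 1) ∈ B
        · rw [flag_of_mem_right hAB hB]
          simp [hqB _ hB, hB]
        · rw [flag_of_notMem hA hB]
          simp [hB]
    linarith

end Reactive

/-! ### Invariant vectors and convergence of occupation frequencies -/

section Invariant

variable {V : Type*} [Fintype V] [DecidableEq V] {p : Matrix V V ℝ}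

theorem vecMul_pow_of_invariant {v : V → ℝ} (hv : ∀ y, ∑ x, v x * p x y = v y) (k : ℕ) (y : V) :
    ∑ x, v x * (p ^ k) x y = v y := by
  have h1 : Matrix.vecMul v p = v := funext hv
  have h2 : Matrix.vecMul v (p ^ k) = v := by
    induction k with
    | zero => simp
    | succ k ih => rw [pow_succ, ← Matrix.vecMul_vecMul, ih, h1]
  exact congrFun h2 y

/-- A nonnegative invariant vector of an irreducible matrix vanishes if one entry does. -/
theorem eq_zero_of_invariant (hp : p.IsIrreducible) {v : V → ℝ} (h0 : ∀ x, 0 ≤ v x)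
    (hv : ∀ y, ∑ x, v x * p x y = v y) {y : V} (hy : v y = 0) (x : V) : v x = 0 := by
  obtain ⟨k, _, hk⟩ := (Matrix.isIrreducible_iff_exists_pow_pos hp.nonneg).1 hp x y
  have h1 := vecMul_pow_of_invariant hv k y
  have hpk : ∀ x y, 0 ≤ (p ^ k) x y := fun x y => Matrix.pow_apply_nonneg hp.nonneg k x y
  rw [hy, Finset.sum_eq_zero_iff_of_nonneg fun x _ => mul_nonneg (h0 x) (hpk x y)] at h1
  exact (mul_eq_zero.1 (h1 x (Finset.mem_univ x))).resolve_right hk.ne'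

theorem IsInvariantProb.pos (hp : p.IsIrreducible) {m : V → ℝ} (hm : IsInvariantProb p m) (x : V) :
    0 < m x := by
  refine lt_of_le_of_ne (hm.nonneg x) fun h => ?_
  have h1 := hm.sum_eq_one
  rw [Finset.sum_eq_zero fun y _ => eq_zero_of_invariant hp hm.nonneg hm.invariant h.symm y] at h1
  exact zero_ne_one h1

theorem IsInvariantProb.unique (hp : p.IsIrreducible) {m m' : V → ℝ} (hm : IsInvariantProb p m)
    (hm' : IsInvariantProb p m') : m' = m := by
  have hne : Nonempty V := by
    by_contra h
    have := hm.sum_eq_one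
    rw [not_nonempty_iff] at h
    simp at this
  -- Subtracting the largest multiple of `m` below `m'` leaves a nonnegative invariant vector with a
  -- zero entry, which must vanish.
  obtain ⟨z, hz⟩ := Finite.exists_min fun x => m' x / m x
  set c := m' z / m z with hc
  have h0 : ∀ x, m' x - c * m x = 0 := by
    refine eq_zero_of_invariant hp (v := fun x => m' x - c * m x) (y := z) (fun x => ?_)
      (fun y => ?_) ?_
    · have := (le_div_iff₀ (hm.pos hp x)).1 (hz x)
      linarith
    · simp only [sub_mul, Finset.sum_sub_distrib, mul_assoc, ← Finset.mul_sum]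
      rw [hm.invariant, hm'.invariant]
    · rw [hc, div_mul_cancel₀ _ (hm.pos hp z).ne', sub_self]
  have hc1 : c = 1 := by
    have h1 : ∑ x, (m' x - c * m x) = 0 := Finset.sum_eq_zero fun x _ => h0 x
    rw [Finset.sum_sub_distrib, ← Finset.mul_sum, hm.sum_eq_one, hm'.sum_eq_one] at h1
    linarith
  funext x
  have := h0 x
  rw [hc1] at this
  linarith

/-- Almost invariant probability vectors converge to the invariant one. -/
theorem IsInvariantProb.tendsto (hp : p.IsIrreducible) {m : V → ℝ} (hm : IsInvariantProb p m)
    {L : ℕ → V → ℝ} (hL0 : ∀ N x, 0 ≤ L N x) (hL1 : ∀ᶠ N in atTop, ∑ x, L N x = 1)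
    (hL : ∀ y, Tendsto (fun N => L N y - ∑ x, L N x * p x y) atTop (𝓝 0)) :
    Tendsto L atTop (𝓝 m) := by
  have hK : IsCompact (stdSimplex ℝ V) := isCompact_stdSimplex ℝ V
  -- In the compact simplex it suffices that every cluster point is `m`; by continuity of the
  -- defect, every cluster point is invariant.
  refine hK.tendsto_nhds_of_unique_mapClusterPt
    (hL1.mono fun N hN => ⟨hL0 N, hN⟩) fun m' hm' hcl => ?_
  refine hm.unique hp ⟨hm'.1, hm'.2, fun y => ?_⟩
  have hcont : Continuous fun v : V → ℝ => v y - ∑ x, v x * p x y := by fun_prop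
  have h1 : MapClusterPt (m' y - ∑ x, m' x * p x y) atTop
      (fun N => L N y - ∑ x, L N x * p x y) := hcl.continuousAt_comp hcont.continuousAt
  have h2 : m' y - ∑ x, m' x * p x y = 0 := by
    have h3 : ClusterPt (m' y - ∑ x, m' x * p x y) (𝓝 0) := h1.clusterPt.mono (hL y)
    exact (eq_of_nhds_neBot h3)
  linarith

end Invariant

theorem sum_range_comp_eq_sum_visits {V : Type*} [Fintype V] [DecidableEq V] (w : ℕ → V)
    (g : V → ℝ) (N : ℕ) :
    ∑ k ∈ Finset.range N, g (w k) = ∑ x, (visits w N x : ℝ) * g x := by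
  induction N with
  | zero => simp [visits]
  | succ N ih =>
    rw [Finset.sum_range_succ, ih]
    simp only [visits_succ, Nat.cast_add, add_mul, Finset.sum_add_distrib]
    simp

theorem sum_visits {V : Type*} [Fintype V] [DecidableEq V] (w : ℕ → V) (N : ℕ) :
    ∑ x, (visits w N x : ℝ) = N := by
  simpa using (sum_range_comp_eq_sum_visits w (fun _ => 1) N).symm

/-- If the empirical transition frequencies of a path are asymptotically those of an irreducible
chain, then the occupation frequencies converge to the invariant probability measure. -/
theorem IsInvariantProb.tendsto_visits {V : Type*} [Fintype V] [DecidableEq V] {p : Matrix V V ℝ}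
    (hp : p.IsIrreducible) {m : V → ℝ} (hm : IsInvariantProb p m) {w : ℕ → V}
    (hw : ∀ y, Tendsto (fun N : ℕ => (∑ k ∈ Finset.range N,
      ((if w (k + 1) = y then 1 else 0) - p (w k) y)) / (N : ℝ)) atTop (𝓝 0)) (x : V) :
    Tendsto (fun N : ℕ => (visits w N x : ℝ) / N) atTop (𝓝 (m x)) := by
  refine (tendsto_pi_nhds.1 (hm.tendsto hp (L := fun N x => (visits w N x : ℝ) / N)
    (fun N x => by positivity) ?_ fun y => ?_)) x
  · filter_upwards [eventually_gt_atTop 0] with N hN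
    rw [← Finset.sum_div, sum_visits, div_self (by positivity)]
  · have hb : Tendsto (fun N : ℕ => ((if w 0 = y then 1 else 0) - (if w N = y then 1 else 0) : ℝ) / N)
        atTop (𝓝 0) := by
      refine tendsto_bdd_div_atTop_nhds_zero (b := -1) (B := 1) ?_ ?_ tendsto_natCast_atTop_atTop
      · exact Eventually.of_forall fun N => by split_ifs <;> norm_num
      · exact Eventually.of_forall fun N => by split_ifs <;> norm_num
    have h := (hw y).add hb
    rw [add_zero] at h
    refine h.congr fun N => ?_
    have h1 : (visits w N y : ℝ) = ∑ k ∈ Finset.range N, if w k = y then 1 else 0 := by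
      simp [visits]
    have h2 : ∑ x, (visits w N x : ℝ) * p x y = ∑ k ∈ Finset.range N, p (w k) y :=
      (sum_range_comp_eq_sum_visits w (fun x => p x y) N).symm
    have h3 : (∑ k ∈ Finset.range N, ((if w (k + 1) = y then 1 else 0) : ℝ)) =
        (∑ k ∈ Finset.range N, if w k = y then 1 else 0) - (if w 0 = y then 1 else 0) +
          if w N = y then 1 else 0 := by
      have := Finset.sum_range_sub (fun k => ((if w k = y then 1 else 0) : ℝ)) N
      rw [Finset.sum_sub_distrib] at this
      linarith
    have h4 : ∑ x, (visits w N x : ℝ) / N * p x y = (∑ x, (visits w N x : ℝ) * p x y) / N := by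
      rw [Finset.sum_div]
      exact Finset.sum_congr rfl fun x _ => by ring
    rw [h4, h2, Finset.sum_sub_distrib, h3, ← add_div, ← sub_div, h1]
    ring

theorem tendsto_average {V : Type*} [Fintype V] [DecidableEq V] {m : V → ℝ} {w : ℕ → V}
    (hw : ∀ x, Tendsto (fun N : ℕ => (visits w N x : ℝ) / N) atTop (𝓝 (m x))) (g : V → ℝ) :
    Tendsto (fun N : ℕ => (∑ k ∈ Finset.range N, g (w k)) / (N : ℝ)) atTop
      (𝓝 (∑ x, m x * g x)) := by
  refine (tendsto_finsetSum Finset.univ fun x _ => (hw x).mul_const (g x)).congr fun N => ?_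
  rw [sum_range_comp_eq_sum_visits, Finset.sum_div]
  exact Finset.sum_congr rfl fun x _ => by ring

/-! ### Holding times: means, positivity and truncation -/

namespace JumpNetwork

variable {V : Type*} [Fintype V] (G : JumpNetwork V)

/-- The point mass at a sink would be an invariant vector with a zero entry elsewhere. -/
theorem not_isSink_of_isIrreducible [DecidableEq V] [Nontrivial V] (hp : G.p.IsIrreducible)
    (x : V) : ¬ G.IsSink x := by
  intro hx
  obtain ⟨y, hy⟩ := exists_ne x
  have h := eq_zero_of_invariant hp (v := fun z => if z = x then 1 else 0)
    (fun z => by split_ifs <;> norm_num) (fun z => by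
      simp only [ite_mul, one_mul, zero_mul, Finset.sum_ite_eq', Finset.mem_univ, if_true]
      simp [p, hx]) (y := y) (by simp [hy]) x
  simp at h

variable [MeasurableSpace V] [MeasurableSingletonClass V]

theorem integrable_jumpLaw_snd {x : V} (hx : ¬ G.IsSink x) (hκ : G.κ x ≠ ⊤) :
    Integrable (fun z : V × ℝ => z.2) (G.jumpLaw x) := by
  refine ⟨measurable_snd.aestronglyMeasurable, ?_⟩
  rw [hasFiniteIntegral_iff_ofReal ((G.ae_jumpLaw_pos x).mono fun z hz => le_of_lt hz),
    G.lintegral_jumpLaw_snd hx]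
  exact hκ.lt_top

theorem integral_jumpLaw_snd {x : V} (hx : ¬ G.IsSink x) :
    ∫ z, z.2 ∂(G.jumpLaw x) = (G.κ x).toReal := by
  rw [integral_eq_lintegral_of_nonneg_ae ((G.ae_jumpLaw_pos x).mono fun z hz => le_of_lt hz)
    measurable_snd.aestronglyMeasurable, G.lintegral_jumpLaw_snd hx]

theorem κ_pos {x : V} (hx : ¬ G.IsSink x) : 0 < G.κ x := by
  have := G.isProbabilityMeasure_jumpLaw hx
  rw [← G.lintegral_jumpLaw_snd hx, lintegral_pos_iff_support measurable_snd.ennreal_ofReal]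
  have h : G.jumpLaw x (Function.support fun z : V × ℝ => ENNReal.ofReal z.2) =
      G.jumpLaw x Set.univ := by
    refine measure_congr ((G.ae_jumpLaw_pos x).mono fun z hz => ?_)
    exact propext ⟨fun _ => trivial, fun _ => (ENNReal.ofReal_pos.2 hz).ne'⟩
  rw [h, measure_univ]
  exact zero_lt_one

theorem integrable_jumpLaw_min {x : V} (hx : ¬ G.IsSink x) (K : ℕ) :
    Integrable (fun z : V × ℝ => min z.2 K) (G.jumpLaw x) := by
  have := G.isProbabilityMeasure_jumpLaw hx
  refine Integrable.of_bound (measurable_snd.min measurable_const).aestronglyMeasurable K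
    ((G.ae_jumpLaw_pos x).mono fun z hz => ?_)
  rw [Real.norm_of_nonneg (le_min hz.le (Nat.cast_nonneg K))]
  exact min_le_right _ _

theorem integral_jumpLaw_min_nonneg (x : V) (K : ℕ) : 0 ≤ ∫ z, min z.2 (K : ℝ) ∂(G.jumpLaw x) :=
  integral_nonneg_of_ae ((G.ae_jumpLaw_pos x).mono fun _ hz => le_min hz.le (Nat.cast_nonneg K))

/-- Monotone convergence. The truncations are integrable, so the law of large numbers applies to
them even when `κ` is infinite. -/
theorem tendsto_integral_jumpLaw_min {x : V} (hx : ¬ G.IsSink x) (hκ : G.κ x = ⊤) :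
    Tendsto (fun K : ℕ => ∫ z, min z.2 (K : ℝ) ∂(G.jumpLaw x)) atTop atTop := by
  rw [← ENNReal.tendsto_ofReal_nhds_top]
  have h : Tendsto (fun K : ℕ => ∫⁻ z, ENNReal.ofReal (min z.2 (K : ℝ)) ∂(G.jumpLaw x)) atTop
      (𝓝 (∫⁻ z, ENNReal.ofReal z.2 ∂(G.jumpLaw x))) := by
    refine lintegral_tendsto_of_tendsto_of_monotone
      (fun K => (measurable_snd.min measurable_const).ennreal_ofReal.aemeasurable)
      (Eventually.of_forall fun _ => fun K K' h => ENNReal.ofReal_le_ofReal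
        (min_le_min_left _ (Nat.cast_le.2 h))) (Eventually.of_forall fun z => ?_)
    obtain ⟨K₀, hK₀⟩ := exists_nat_ge z.2
    refine tendsto_const_nhds.congr' ?_
    filter_upwards [eventually_ge_atTop K₀] with K hK
    rw [min_eq_left (hK₀.trans (Nat.cast_le.2 hK))]
  rw [G.lintegral_jumpLaw_snd hx, hκ] at h
  refine h.congr fun K => ?_
  rw [ofReal_integral_eq_lintegral_ofReal (G.integrable_jumpLaw_min hx K)
    ((G.ae_jumpLaw_pos x).mono fun z hz => le_min hz.le (Nat.cast_nonneg K))]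

end JumpNetwork

/-! ### Almost sure limits along a trajectory -/

namespace IsJumpTrajectory

variable {V : Type*} [Fintype V] [DecidableEq V] [MeasurableSpace V] [MeasurableSingletonClass V]
  {G : JumpNetwork V} {Ω : Type*} [MeasurableSpace Ω] {P : Measure Ω} [IsProbabilityMeasure P]
  {X : ℕ → Ω → V} {t : ℕ → Ω → ℝ}

/-- Strong law of large numbers along a trajectory, for functions of the present node, the flag,
the next node and the holding time. -/
theorem lln (hX : IsJumpTrajectory G P X t) (hs : ∀ x, ¬ G.IsSink x) (A B : Finset V)
    (f : V × Bool → V × ℝ → ℝ) (hf : ∀ e, Measurable (f e))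
    (hfi : ∀ e, Integrable (f e) (G.jumpLaw e.1)) :
    ∀ᵐ ω ∂P, Tendsto (fun N : ℕ => (∑ k ∈ Finset.range N,
        (f (stateSeq (flagInit A B) (flagNext A B) (fun n => X n ω) k)
            (X (k + 1) ω, t (k + 1) ω - t k ω) -
          ∫ z, f (stateSeq (flagInit A B) (flagNext A B) (fun n => X n ω) k) z
            ∂(G.jumpLaw (X k ω)))) / (N : ℝ)) atTop (𝓝 0) := by
  have hpr : ∀ e : V × Bool, IsProbabilityMeasure (G.jumpLaw e.1) := fun e =>
    G.isProbabilityMeasure_jumpLaw (hs e.1)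
  -- Each node is paired with the holding time that precedes it. The first node has none and gets
  -- the dummy value `0`, so its box side `S 0` matters only through whether it contains `0`.
  set Z : ℕ → Ω → V × ℝ := fun n ω => (X n ω, Nat.casesOn n 0 fun k => t (k + 1) ω - t k ω) with hZ
  have hmZ : ∀ n, Measurable (Z n) := by
    intro n
    cases n with
    | zero => exact (hX.measurable_X 0).prodMk measurable_const
    | succ n =>
      exact (hX.measurable_X (n + 1)).prodMk ((hX.measurable_t (n + 1)).sub (hX.measurable_t n))
  have hpμ : IsProbabilityMeasure (P.map (Z 0)) :=
    Measure.isProbabilityMeasure_map (hmZ 0).aemeasurable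
  have h := path_lln (flagInit A B) (flagNext A B) (P.map (Z 0)) (fun e => G.jumpLaw e.1) P Z hmZ
    (fun n y S hS => ?_) f hf hfi
  · filter_upwards [h] with ω hω
    refine hω.congr fun N => ?_
    congr 1
    refine Finset.sum_congr rfl fun k _ => ?_
    rw [stateSeq_flag_fst]
  · rw [Measure.map_apply (hmZ 0) ((measurableSet_singleton _).prod (hS 0))]
    simp only [stateSeq_flag_fst]
    by_cases h0 : (0 : ℝ) ∈ S 0
    · have e1 : {ω | ∀ k ≤ n, Z k ω ∈ ({y k} : Set V) ×ˢ S k} =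
          {ω | (∀ k ≤ n, X k ω = y k) ∧ ∀ k < n, t (k + 1) ω - t k ω ∈ S (k + 1)} := by
        ext ω
        constructor
        · exact fun h => ⟨fun k hk => (h k hk).1, fun k hk => (h (k + 1) hk).2⟩
        · rintro ⟨h1, h2⟩ k hk
          refine ⟨h1 k hk, ?_⟩
          cases k with
          | zero => exact h0
          | succ k => exact h2 k hk
      have e2 : Z 0 ⁻¹' (({y 0} : Set V) ×ˢ S 0) = {ω | X 0 ω = y 0} := by
        ext ω
        exact ⟨fun h => h.1, fun h => ⟨h, h0⟩⟩
      have key := hX.law n y (fun k => S (k + 1)) fun k => hS (k + 1)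
      rw [e1, e2]
      refine (ENNReal.toReal_eq_toReal_iff' (measure_ne_top _ _) ?_).1 ?_
      · exact ENNReal.mul_ne_top (measure_ne_top _ _) (ENNReal.prod_ne_top fun k _ =>
          have := hpr (y k, true); measure_ne_top (G.jumpLaw (y k)) _)
      · rw [ENNReal.toReal_mul, ENNReal.toReal_prod]
        refine key.trans ?_
        congr 1
        exact Finset.prod_congr rfl fun k _ => G.setIntegral_b _ _ (hS (k + 1))
    · have e1 : {ω | ∀ k ≤ n, Z k ω ∈ ({y k} : Set V) ×ˢ S k} = ∅ :=
        Set.eq_empty_of_forall_notMem fun ω h => h0 (h 0 (Nat.zero_le n)).2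
      have e2 : Z 0 ⁻¹' (({y 0} : Set V) ×ˢ S 0) = ∅ :=
        Set.eq_empty_of_forall_notMem fun ω h => h0 h.2
      rw [e1, e2, measure_empty, zero_mul]

/-- The occupation frequencies converge to the invariant probability measure. -/
theorem ae_tendsto_visits (hX : IsJumpTrajectory G P X t) (hs : ∀ x, ¬ G.IsSink x)
    (hp : G.p.IsIrreducible) {m : V → ℝ} (hm : IsInvariantProb G.p m) :
    ∀ᵐ ω ∂P, ∀ x, Tendsto (fun N : ℕ => (visits (fun n => X n ω) N x : ℝ) / N) atTop
      (𝓝 (m x)) := by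
  have h : ∀ y, ∀ᵐ ω ∂P, Tendsto (fun N : ℕ => (∑ k ∈ Finset.range N,
      ((if X (k + 1) ω = y then 1 else 0) - G.p (X k ω) y)) / (N : ℝ)) atTop (𝓝 0) := by
    intro y
    have hmy : Measurable fun z : V × ℝ => if z.1 = y then (1 : ℝ) else 0 :=
      (Measurable.of_discrete (f := fun x : V => if x = y then (1 : ℝ) else 0)).comp measurable_fst
    refine (hX.lln hs ∅ ∅ (fun _ z => if z.1 = y then 1 else 0) (fun _ => hmy) fun e => ?_).mono
      fun ω hω => hω.congr fun N => ?_
    · have := G.isProbabilityMeasure_jumpLaw (hs e.1)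
      exact Integrable.of_bound hmy.aestronglyMeasurable 1
        (Eventually.of_forall fun z => by split_ifs <;> simp)
    · simp only [G.integral_jumpLaw_fst (hs _) (fun x => if x = y then 1 else 0)]
      simp
  filter_upwards [ae_all_iff.2 h] with ω hω x
  exact hm.tendsto_visits hp (w := fun n => X n ω) hω x

/-- The averages of a function of the holding times converge. -/
theorem ae_tendsto_holding (hX : IsJumpTrajectory G P X t) (hs : ∀ x, ¬ G.IsSink x)
    (hp : G.p.IsIrreducible) {m : V → ℝ} (hm : IsInvariantProb G.p m) {h : ℝ → ℝ}
    (hh : Measurable h) (hi : ∀ x, Integrable (fun z : V × ℝ => h z.2) (G.jumpLaw x)) :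
    ∀ᵐ ω ∂P, Tendsto (fun N : ℕ => (∑ k ∈ Finset.range N, h (t (k + 1) ω - t k ω)) / (N : ℝ)) atTop
      (𝓝 (∑ x, m x * ∫ z, h z.2 ∂(G.jumpLaw x))) := by
  filter_upwards [hX.lln hs ∅ ∅ (fun _ z => h z.2) (fun _ => hh.comp measurable_snd)
    fun e => hi e.1, hX.ae_tendsto_visits hs hp hm] with ω h1 h2
  have h3 := h1.add (tendsto_average h2 fun x => ∫ z, h z.2 ∂(G.jumpLaw x))
  rw [zero_add] at h3
  refine h3.congr fun N => ?_
  rw [← add_div, Finset.sum_sub_distrib, sub_add_cancel]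

/-- The number of reactive pieces of the trajectory per jump converges. -/
theorem ae_tendsto_numReactive (hX : IsJumpTrajectory G P X t) (hs : ∀ x, ¬ G.IsSink x)
    (hp : G.p.IsIrreducible) {m : V → ℝ} (hm : IsInvariantProb G.p m) {A B : Finset V}
    (hAB : Disjoint A B) :
    ∀ᵐ ω ∂P, Tendsto (fun N : ℕ =>
      (numReactive (fun n => X n ω) (A : Set V) (B : Set V) N : ℝ) / N) atTop
      (𝓝 (∑ x ∈ A, ∑ y, m x * G.p x y * G.q (A : Set V) (B : Set V) y)) := by
  set q := G.q (A : Set V) (B : Set V) with hq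
  set r : V → ℝ := fun x => ∑ y, G.p x y * q y with hr
  have hq01 : ∀ x, 0 ≤ q x ∧ q x ≤ 1 := fun x => ⟨measureReal_nonneg, measureReal_le_one⟩
  -- The flag is part of the automaton state, so the flagged committor at the next node is an
  -- admissible summand. Its conditional mean is `r` at the present node when the flag is set, and
  -- `0` otherwise.
  set f : V × Bool → V × ℝ → ℝ := fun e z => if e.2 = true then q z.1 else 0 with hf
  have hmf : ∀ e, Measurable (f e) := fun e => by
    simp only [hf]
    split_ifs
    · exact (Measurable.of_discrete (f := q)).comp measurable_fst
    · exact measurable_const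
  have hfi : ∀ e, Integrable (f e) (G.jumpLaw e.1) := fun e => by
    have := G.isProbabilityMeasure_jumpLaw (hs e.1)
    refine Integrable.of_bound (hmf e).aestronglyMeasurable 1 (Eventually.of_forall fun z => ?_)
    simp only [hf]
    split_ifs
    · rw [Real.norm_of_nonneg (hq01 _).1]; exact (hq01 _).2
    · simp
  have hint : ∀ (s : Bool) (x : V), ∫ z, f (x, s) z ∂(G.jumpLaw x) = if s = true then r x else 0 := by
    intro s x
    cases s
    · simp [hf]
    · simpa [hf, hr] using G.integral_jumpLaw_fst (hs x) q
  filter_upwards [hX.lln hs A B f hmf hfi, hX.ae_tendsto_visits hs hp hm] with ω h1 h2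
  set w : ℕ → V := fun n => X n ω with hw
  have h3 : Tendsto (fun N : ℕ => (if (stateSeq (flagInit A B) (flagNext A B) w N).2 = true
      then q (w N) else 0) / (N : ℝ)) atTop (𝓝 0) := by
    refine tendsto_bdd_div_atTop_nhds_zero (b := 0) (B := 1) ?_ ?_ tendsto_natCast_atTop_atTop
    · refine Eventually.of_forall fun N => ?_
      split_ifs
      · exact (hq01 _).1
      · exact le_rfl
    · refine Eventually.of_forall fun N => ?_
      split_ifs
      · exact (hq01 _).2
      · exact zero_le_one
  have h4 := (h1.add (tendsto_average h2 ((A : Set V).indicator r))).sub h3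
  have hlim : 0 + ∑ x, m x * (A : Set V).indicator r x - 0 =
      ∑ x ∈ A, ∑ y, m x * G.p x y * q y := by
    rw [zero_add, sub_zero, ← Finset.sum_subset (Finset.subset_univ A)]
    · refine Finset.sum_congr rfl fun x hx => ?_
      rw [Set.indicator_of_mem (Finset.mem_coe.2 hx), hr, Finset.mul_sum]
      exact Finset.sum_congr rfl fun y _ => by ring
    · intro x _ hx
      rw [Set.indicator_of_notMem (by simpa using hx), mul_zero]
  rw [hlim] at h4
  refine h4.congr fun N => ?_
  rw [numReactive_eq_arrivals hAB, arrivals_eq_sum hAB w (q := q) (r := r)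
    (fun x hx => G.q_eq_zero hx)
    (fun x hx => G.q_eq_one hx (by simpa using Finset.disjoint_right.1 hAB hx))
    (fun x hA hB => G.q_harmonic (by simpa using hA) (by simpa using hB)), sub_div, add_div]
  congr 3
  refine Finset.sum_congr rfl fun k _ => ?_
  have hk : stateSeq (flagInit A B) (flagNext A B) w k =
      (w k, (stateSeq (flagInit A B) (flagNext A B) w k).2) := by
    rw [← stateSeq_flag_fst (A := A) (B := B) w k]
  rw [hk, hint]

end IsJumpTrajectory

/-! ### The reaction rate -/

theorem mainTheorem9 {V : Type*} [Fintype V] [DecidableEq V] [MeasurableSpace V]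
    [MeasurableSingletonClass V] (G : JumpNetwork V) (A B : Finset V)
    (hA : A.Nonempty) (hB : B.Nonempty) (hAB : Disjoint A B)
    (hp : IsErgodicChain G.p) (m : V → ℝ) (hm : IsInvariantProb G.p m)
    {Ω : Type*} [MeasurableSpace Ω] (P : Measure Ω) [IsProbabilityMeasure P]
    (X : ℕ → Ω → V) (t : ℕ → Ω → ℝ) (hX : IsJumpTrajectory G P X t) :
    IsReactionRate P X t (A : Set V) (B : Set V)
      (ENNReal.ofReal (∑ x ∈ A, ∑ y, m x * G.p x y * G.q (A : Set V) (B : Set V) y) /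
        ∑ x, ENNReal.ofReal (m x) * G.κ x).toReal := by
  obtain ⟨a, ha⟩ := hA
  obtain ⟨b, hb⟩ := hB
  have : Nontrivial V := ⟨a, b, fun h => Finset.disjoint_left.1 hAB ha (h ▸ hb)⟩
  have hirr := hp.irreducible
  have hs := G.not_isSink_of_isIrreducible hirr
  have hpos := hm.pos hirr
  set c := ∑ x ∈ A, ∑ y, m x * G.p x y * G.q (A : Set V) (B : Set V) y with hc
  have hc0 : 0 ≤ c := Finset.sum_nonneg fun x _ => Finset.sum_nonneg fun y _ =>
    mul_nonneg (mul_nonneg (hm.nonneg x) (G.p_nonneg x y)) measureReal_nonneg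
  have ht : ∀ ω (N : ℕ), t N ω = ∑ k ∈ Finset.range N, (t (k + 1) ω - t k ω) := fun ω N => by
    rw [Finset.sum_range_sub (fun k => t k ω), hX.t_zero, sub_zero]
  have hM := hX.ae_tendsto_numReactive hs hirr hm hAB
  have hdiv : ∀ (M : ℕ → ℝ) (T : ℕ → ℝ), (fun N : ℕ => (M N / N) / (T N / N)) =ᶠ[atTop]
      fun N => M N / T N := fun M T => by
    filter_upwards [eventually_gt_atTop 0] with N hN
    exact div_div_div_cancel_right₀ (by positivity) _ _
  by_cases hκ : ∀ x, G.κ x ≠ ⊤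
  · set d := ∑ x, m x * (G.κ x).toReal with hd
    -- Positivity of the limit of `t N / N` is what permits dividing the two limits.
    have hdpos : 0 < d := Finset.sum_pos (fun x _ => mul_pos (hpos x)
      (ENNReal.toReal_pos (G.κ_pos (hs x)).ne' (hκ x))) ⟨a, Finset.mem_univ a⟩
    have hk : (ENNReal.ofReal c / ∑ x, ENNReal.ofReal (m x) * G.κ x).toReal = c / d := by
      rw [ENNReal.toReal_div, ENNReal.toReal_ofReal hc0, ENNReal.toReal_sum fun x _ =>
        ENNReal.mul_ne_top ENNReal.ofReal_ne_top (hκ x)]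
      simp only [ENNReal.toReal_mul, ENNReal.toReal_ofReal (hm.nonneg _), hd]
    rw [hk]
    filter_upwards [hM, hX.ae_tendsto_holding hs hirr hm measurable_id fun x =>
      G.integrable_jumpLaw_snd (hs x) (hκ x)] with ω h1 h2
    simp only [id, G.integral_jumpLaw_snd (hs _), ← ht] at h2
    exact (h1.div h2 hdpos.ne').congr' (hdiv _ _)
  · push Not at hκ
    obtain ⟨x₀, hx₀⟩ := hκ
    have hk : (ENNReal.ofReal c / ∑ x, ENNReal.ofReal (m x) * G.κ x).toReal = 0 := by
      have : ∑ x, ENNReal.ofReal (m x) * G.κ x = ⊤ :=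
        ENNReal.sum_eq_top.2 ⟨x₀, Finset.mem_univ _, by
          rw [hx₀, ENNReal.mul_top (ENNReal.ofReal_pos.2 (hpos x₀)).ne']⟩
      rw [this, ENNReal.div_top, ENNReal.toReal_zero]
    rw [hk]
    filter_upwards [hM, ae_all_iff.2 fun K : ℕ => hX.ae_tendsto_holding hs hirr hm
      (measurable_id.min (measurable_const (a := (K : ℝ)))) fun x =>
        G.integrable_jumpLaw_min (hs x) K] with ω h1 h2
    -- For each `K`, `t N / N` dominates the average of the holding times truncated at `K`. The
    -- limit of that average contains the term of `x₀`, which is unbounded in `K` because `m x₀ >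
    -- 0`.
    have h3 : Tendsto (fun N : ℕ => t N ω / N) atTop atTop := by
      refine tendsto_atTop.2 fun C => ?_
      obtain ⟨K, hK⟩ := ((G.tendsto_integral_jumpLaw_min (hs x₀) hx₀).const_mul_atTop
        (hpos x₀)).eventually_gt_atTop C |>.exists
      have hlt : C < ∑ x, m x * ∫ z, min z.2 (K : ℝ) ∂(G.jumpLaw x) :=
        hK.trans_le (Finset.single_le_sum
          (f := fun x => m x * ∫ z, min z.2 (K : ℝ) ∂(G.jumpLaw x))
          (fun x _ => mul_nonneg (hm.nonneg x) (G.integral_jumpLaw_min_nonneg x K))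
          (Finset.mem_univ x₀))
      filter_upwards [(h2 K).eventually_const_lt hlt] with N hN
      refine hN.le.trans (div_le_div_of_nonneg_right ?_ (Nat.cast_nonneg N))
      rw [ht]
      exact Finset.sum_le_sum fun k _ => min_le_left _ _
    exact (h1.div_atTop h3).congr' (hdiv _ _)
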